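/- Let $p,q\in\mathbb N=\{1,2,\dots\}$. For $k\ge 0$ let $\boldsymbol m^{[r]}_k(x)=x^{\lfloor k/r\rfloor}\boldsymbol e_{(k \bmod r)}\in\mathbb C^r[x]$ (components counted from $0$) be the $k$-th column of $X_{[r]}^\top(x)=(I_r,\,xI_r,\,x^2I_r,\dots)$. For a $q\times p$ matrix $u$ of linear functionals on polynomials (written as integration against a matrix of generalized measures), *mixed multiple orthogonality for $u$ exists* if there are $B=SX_{[q]}$ with $S$ lower unitriangular and $A=X_{[p]}^\top U$ with $U$ upper triangular and nonsingular (rows $B_n\in\mathbb C^{1\times q}[x]$ of $B$, columns $A_n\in\mathbb C^{p}[x]$ of $A$, $n\in\mathbb N_0$), such that $\int B_n\,\mathrm du\,A_m=\delta_{n,m}$ for all $n,m\in\mathbb N_0$. Let $\mathrm d\mu=(\mathrm d\mu_{b,a})$ be a $q\times p$ matrix of measures on $\mathbb R$ with finite moments, $\mu_{b,a}$ being carried by a closed set $\Delta_{b,a}$; put $\Delta=\bigcup\Delta_{b,a}$. Assume that the orthogonality for $\mu$ exists, with polynomials $B_n,A_n$. Let $R(x)=\sum_{l=0}^NR_lx^l$,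 $N\ge1$, $R_l\in\mathbb C^{p\times p}$, and $0\le r\le p-1$ be such that $$R_N=\begin{bmatrix}0_{(p-r)\times r}&I_{p-r}\\0_{r\times r}&0_{r\times(p-r)}\end{bmatrix},\qquad R_{N-1}=\begin{bmatrix}*&*\\I_r&*\end{bmatrix}$$ (the same block sizes, arbitrary $*$), so that $\deg\det R=Np-r$. Let $x_1,\dots,x_M\in\mathbb C$ be the distinct zeros of $\det R$, and assume that none of them lies in $\Delta$. For each $i$ let $\kappa_{i,1},\dots,\kappa_{i,s_i}\ge1$ be the partial multiplicities of $R$ at $x_i$, and let row vectors $\boldsymbol v^L_{i,j;k}$ and column vectors $\boldsymbol v^R_{i,j;k}$ ($1\le j\le s_i$, $0\le k<\kappa_{i,j}$) be canonical sets of left and right Jordan chains: $\sum_{l=0}^k\frac1{l!}\boldsymbol v^L_{i,j;k-l}R^{(l)}(x_i)=0$ and $\sum_{l=0}^k\frac1{l!}R^{(l)}(x_i)\boldsymbol v^R_{i,j;k-l}=0$, the $\boldsymbol v^L_{i,j;0}$ ($1\le j\le s_i$) linearly independent, likewise the $\boldsymbol v^R_{i,j;0}$, and $\sum_j\kappa_{i,j}$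 equal to the multiplicity of $x_i$ as a zero of $\det R$. Let $\boldsymbol\xi_{i,j,k}$ be $\mathbb C^q$-valued (column) functions analytic at $x_i$, and let $$\mathrm d\check\mu(x)=\mathrm d\mu(x)R^{-1}(x)+\sum_{i=1}^M\sum_{j=1}^{s_i}\sum_{k=0}^{\kappa_{i,j}-1}\boldsymbol\xi_{i,j,k}(x)\sum_{l=0}^k\frac{(-1)^l}{l!}\boldsymbol v^L_{i,j;k-l}\,\delta^{(l)}(x-x_i)$$ be the Geronimus perturbed matrix of (generalized) measures, so that $\mathrm d\check\mu\,R=\mathrm d\mu$; here $\int g(x)\delta^{(l)}(x-x_i)\,\mathrm dx=(-1)^lg^{(l)}(x_i)$. Put $D_n(z)=\int_\Delta B_n(t)\frac{\mathrm d\mu(t)}{z-t}$ and let $\mathbb D_n-\mathbb W_n$ be the row vector of length $\sum_{i,j}\kappa_{i,j}=Np-r$ whose entries, for $(i,j,k)$ in lexicographic order, are $\mathbb D_n^{(i,j,k)}-\mathbb W_n^{(i,j,k)}$, with $$\mathbb D_n^{(i,j,k)}=\sum_{l=0}^k\frac1{l!}D_n^{(l)}(x_i)\boldsymbol v^R_{i,j;k-l},\qquad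 \mathbb W_n^{(i,j,k)}=\lim_{z\to x_i}\sum_{l=0}^k\frac1{l!}F_{n,i}^{(l)}(z)\boldsymbol v^R_{i,j;k-l},$$ $$F_{n,i}(z)=\sum_{\tilde\jmath=1}^{s_i}\sum_{\tilde k=0}^{\kappa_{i,\tilde\jmath}-1}\sum_{\tilde l=0}^{\tilde k}\frac1{\tilde l!}\,\frac{\partial^{\tilde l}}{\partial t^{\tilde l}}\left[\frac{B_n(t)\boldsymbol\xi_{i,\tilde\jmath,\tilde k}(t)}{z-t}\right]_{t=x_i}\boldsymbol v^L_{i,\tilde\jmath;\tilde k-\tilde l}R(z).$$ Further put $\mathbb I_{i,l}=\int B_i\,\mathrm d\check\mu\,\boldsymbol m^{[p]}_l$ and $\tilde\tau_n=\det(\mathbb I_{i,l})_{0\le i,l\le n}$. Define $\tau_n$ for all $n\in\mathbb N_0$ by $$\tau_n=\tilde\tau_n\quad(0\le n\le Np-r-2),\qquad \tau_n=\det\begin{bmatrix}\mathbb D_{n-Np+r+1}-\mathbb W_{n-Np+r+1}\\\vdots\\\mathbb D_n-\mathbb W_n\end{bmatrix}\quad(n\ge Np-r-1).$$ Then the perturbed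 mixed multiple orthogonality, i.e. the orthogonality for $\check\mu$, exists if and only if $\tau_n\ne0$ for all $n\in\mathbb N_0$. Moreover $\tilde\tau_{Np-r-1}\ne0$ if and only if $\tau_{Np-r-1}\ne0$, so that either determinant may be used for $n=Np-r-1$. -/

import Mathlib

open Polynomial
open scoped Matrix Topology

noncomputable section

namespace MixedGeronimus

/-- The `k`-th column (counted from `0`) of `X_[r]ᵀ(x) = (I_r, x I_r, x² I_r, …)`, i.e. the vector
polynomial `x ^ (k / r) • e_{k mod r}`. -/
def mono (r : ℕ) [NeZero r] (k : ℕ) : Fin r → ℂ[X] :=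
  Pi.single (Fin.ofNat r k) (X ^ (k / r))

/-- A `q × p` matrix of functionals on polynomials, e.g. integration against a matrix of measures. -/
abbrev MatFunctional (q p : ℕ) : Type := Fin q → Fin p → ℂ[X] → ℂ

/-- `∫ P(x) dμ(x) Q(x)` for a row vector polynomial `P` and a column vector polynomial `Q`. -/
def pairing {q p : ℕ} (u : MatFunctional q p) (P : Fin q → ℂ[X]) (Q : Fin p → ℂ[X]) : ℂ :=
  ∑ b, ∑ a, u b a (P b * Q a)

/-- `B_n` (rows) and `A_n` (columns) are the mixed multiple orthogonal polynomials on the step line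
for `u`: `B = S X_[q]` with `S` lower unitriangular, `A = X_[p]ᵀ U` with `U` upper triangular and
nonsingular, and `∫ B dμ A = I`. -/
structure IsMixedOrthogonal {q p : ℕ} [NeZero q] [NeZero p] (u : MatFunctional q p)
    (B : ℕ → Fin q → ℂ[X]) (A : ℕ → Fin p → ℂ[X]) : Prop where
  exists_S : ∃ S : ℕ → ℕ → ℂ, ∀ n,
    S n n = 1 ∧ B n = ∑ k ∈ Finset.range (n + 1), S n k • mono q k
  exists_U : ∃ U : ℕ → ℕ → ℂ, ∀ n,
    U n n ≠ 0 ∧ A n = ∑ k ∈ Finset.range (n + 1), U k n • mono p k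
  biorthogonal : ∀ n m, pairing u (B n) (A m) = if n = m then 1 else 0

/-- The mixed orthogonality for `u` exists. -/
def OrthogonalityExists {q p : ℕ} [NeZero q] [NeZero p] (u : MatFunctional q p) : Prop :=
  ∃ (B : ℕ → Fin q → ℂ[X]) (A : ℕ → Fin p → ℂ[X]), IsMixedOrthogonal u B A

/-- Integration of polynomials against a matrix of measures. -/
def ofMeasure {q p : ℕ} (μ : Fin q → Fin p → MeasureTheory.Measure ℝ) : MatFunctional q p :=
  fun b a f => ∫ t, f.eval (t : ℂ) ∂(μ b a)

/-- The matrix `R^{(l)}(z)`. -/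
def derivAt {p : ℕ} (R : Matrix (Fin p) (Fin p) ℂ[X]) (l : ℕ) (z : ℂ) :
    Matrix (Fin p) (Fin p) ℂ :=
  R.map fun f => (derivative^[l] f).eval z

/-- Normalization of the leading and subleading coefficients of `R(x) = ∑_{l ≤ N} R_l x^l`:
`R_N = [0, I_{p-r}; 0, 0]`, and the lower left `r × r` block of `R_{N-1}` is `I_r`
(the first `p - r` rows and the last `p - r` columns of `R_{N-1}` are arbitrary). -/
structure HasLeadingForm {p : ℕ} (R : Matrix (Fin p) (Fin p) ℂ[X]) (N r : ℕ) : Prop where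
  natDegree_le : ∀ a a', (R a a').natDegree ≤ N
  leading : ∀ a a', (R a a').coeff N = if (a' : ℕ) = a + r then 1 else 0
  subleading : ∀ a a' : Fin p, p - r ≤ (a : ℕ) → (a' : ℕ) < r →
    (R a a').coeff (N - 1) = if (a : ℕ) = a' + (p - r) then 1 else 0

/-- A canonical set of left Jordan chains of `R` at `z`: chains `v j 0, …, v j (κ j - 1)` of row
vectors, with linearly independent `v j 0`, whose lengths add up to the multiplicity of `z` as a
zero of `det R`. Values `v j k` with `k ≥ κ j` play no role. -/
structure IsCanonicalLeft {p : ℕ} (R : Matrix (Fin p) (Fin p) ℂ[X]) (z : ℂ) {s : ℕ}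
    (κ : Fin s → ℕ) (v : Fin s → ℕ → Fin p → ℂ) : Prop where
  pos : ∀ j, 0 < κ j
  chain : ∀ j, ∀ k < κ j, ∑ l ∈ Finset.range (k + 1),
    ((l.factorial : ℂ)⁻¹) • (v j (k - l) ᵥ* derivAt R l z) = 0
  linearIndependent : LinearIndependent ℂ fun j => v j 0
  sum_eq : ∑ j, κ j = R.det.rootMultiplicity z

/-- A canonical set of right Jordan chains of `R` at `z` (column vectors). -/
structure IsCanonicalRight {p : ℕ} (R : Matrix (Fin p) (Fin p) ℂ[X]) (z : ℂ) {s : ℕ}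
    (κ : Fin s → ℕ) (v : Fin s → ℕ → Fin p → ℂ) : Prop where
  pos : ∀ j, 0 < κ j
  chain : ∀ j, ∀ k < κ j, ∑ l ∈ Finset.range (k + 1),
    ((l.factorial : ℂ)⁻¹) • (derivAt R l z *ᵥ v j (k - l)) = 0
  linearIndependent : LinearIndependent ℂ fun j => v j 0
  sum_eq : ∑ j, κ j = R.det.rootMultiplicity z

/-- An enumeration `x_1, …, x_M` of the distinct eigenvalues of `R`, with a canonical set of left
and one of right Jordan chains at each of them. -/
structure JordanData {p : ℕ} (R : Matrix (Fin p) (Fin p) ℂ[X]) where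
  /-- number of distinct eigenvalues -/
  M : ℕ
  /-- the eigenvalues -/
  x : Fin M → ℂ
  x_injective : Function.Injective x
  isRoot_iff : ∀ z, R.det.IsRoot z ↔ ∃ i, x i = z
  /-- number of chains at each eigenvalue -/
  s : Fin M → ℕ
  /-- partial multiplicities -/
  κ : (i : Fin M) → Fin (s i) → ℕ
  /-- left Jordan chains -/
  vL : (i : Fin M) → Fin (s i) → ℕ → Fin p → ℂ
  /-- right Jordan chains -/
  vR : (i : Fin M) → Fin (s i) → ℕ → Fin p → ℂ
  left : ∀ i, IsCanonicalLeft R (x i) (κ i) (vL i)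
  right : ∀ i, IsCanonicalRight R (x i) (κ i) (vR i)

section Perturbation

variable {q p : ℕ} {R : Matrix (Fin p) (Fin p) ℂ[X]}

/-- The functional defined by the Geronimus perturbed matrix of measures
`dμ R⁻¹ + ∑_{i,j,k} ξ_{i,j,k} (∑_{l ≤ k} (-1)^l / l! v^L_{i,j;k-l} δ^{(l)}(x - x_i))`,
where `∫ g(x) δ^{(l)}(x - x_i) dx = (-1)^l g^{(l)}(x_i)`. -/
def geronimus (μ : Fin q → Fin p → MeasureTheory.Measure ℝ) (J : JordanData R)
    (ξ : (i : Fin J.M) → Fin (J.s i) → ℕ → ℂ → Fin q → ℂ) : MatFunctional q p :=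
  fun b a f =>
    (∑ a', ∫ t, f.eval (t : ℂ) * ((derivAt R 0 (t : ℂ))⁻¹ a' a) ∂(μ b a')) +
    ∑ i, ∑ j, ∑ k ∈ Finset.range (J.κ i j), ∑ l ∈ Finset.range (k + 1),
      ((l.factorial : ℂ)⁻¹) * iteratedDeriv l (fun t => f.eval t * ξ i j k t b) (J.x i) *
        J.vL i j (k - l) a

/-- The Cauchy transform `D_n(z) = ∫ B_n(t) dμ(t) / (z - t)`, a row vector. -/
def cauchyD (μ : Fin q → Fin p → MeasureTheory.Measure ℝ) (B : ℕ → Fin q → ℂ[X])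
    (n : ℕ) (z : ℂ) (a : Fin p) : ℂ :=
  ∑ b, ∫ t, (B n b).eval (t : ℂ) / (z - (t : ℂ)) ∂(μ b a)

/-- The action on the right of the `k`-th element of the `j`-th right Jordan chain at `x_i` on a row
vector function: `∑_{l ≤ k} 1/l! F^{(l)}(z) v^R_{i,j;k-l}`. -/
def chainAction (J : JordanData R) (i : Fin J.M) (j : Fin (J.s i)) (k : ℕ)
    (F : ℂ → Fin p → ℂ) (z : ℂ) : ℂ :=
  ∑ l ∈ Finset.range (k + 1), ((l.factorial : ℂ)⁻¹) *
    ∑ a, iteratedDeriv l (fun y => F y a) z * J.vR i j (k - l) a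

/-- The entry of `𝔻_n` with indices `i, j, k`. -/
def entryD (μ : Fin q → Fin p → MeasureTheory.Measure ℝ) (J : JordanData R)
    (B : ℕ → Fin q → ℂ[X]) (n : ℕ) (i : Fin J.M) (j : Fin (J.s i)) (k : ℕ) : ℂ :=
  chainAction J i j k (cauchyD μ B n) (J.x i)

/-- The Cauchy transform of the part of the discrete masses at `x_i`, multiplied by `R`:
`∫ B_n(t) ∑_{j,k} ξ_{i,j,k}(t) ∑_{l ≤ k} (-1)^l / l! v^L_{i,j;k-l} δ^{(l)}(t - x_i) R(z) / (z - t) dt`. -/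
def massTransform (J : JordanData R) (ξ : (i : Fin J.M) → Fin (J.s i) → ℕ → ℂ → Fin q → ℂ)
    (B : ℕ → Fin q → ℂ[X]) (n : ℕ) (i : Fin J.M) (z : ℂ) : Fin p → ℂ :=
  ∑ j, ∑ k ∈ Finset.range (J.κ i j), ∑ l ∈ Finset.range (k + 1),
    (((l.factorial : ℂ)⁻¹) *
      iteratedDeriv l (fun t => (∑ b, (B n b).eval t * ξ i j k t b) / (z - t)) (J.x i)) •
      (J.vL i j (k - l) ᵥ* derivAt R 0 z)

/-- The entry of `𝕎_n` with indices `i, j, k`, a limit `z → x_i`. -/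
def entryW (J : JordanData R) (ξ : (i : Fin J.M) → Fin (J.s i) → ℕ → ℂ → Fin q → ℂ)
    (B : ℕ → Fin q → ℂ[X]) (n : ℕ) (i : Fin J.M) (j : Fin (J.s i)) (k : ℕ) : ℂ :=
  Filter.limUnder (𝓝[≠] (J.x i)) (chainAction J i j k (massTransform J ξ B n i))

/-- The number of columns of the matrices `𝔻 - 𝕎`, which is `deg det R`. -/
abbrev JordanData.size (J : JordanData R) : ℕ := ∑ i, ∑ j, J.κ i j

/-- The lexicographic enumeration of the triples `i, j, k`. -/
def JordanData.index (J : JordanData R) :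
    Fin J.size ≃ (i : Fin J.M) × (j : Fin (J.s i)) × Fin (J.κ i j) :=
  finSigmaFinEquiv.symm.trans (Equiv.sigmaCongrRight fun _ => finSigmaFinEquiv.symm)

/-- The row vector `𝔻_n - 𝕎_n`. -/
def rowDW (μ : Fin q → Fin p → MeasureTheory.Measure ℝ) (J : JordanData R)
    (ξ : (i : Fin J.M) → Fin (J.s i) → ℕ → ℂ → Fin q → ℂ)
    (B : ℕ → Fin q → ℂ[X]) (n : ℕ) (c : Fin J.size) : ℂ :=
  let ⟨i, j, k⟩ := J.index c
  entryD μ J B n i j k - entryW J ξ B n i j k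

/-- The integrals `𝕀_{i,l} = ∫ B_i dμ̌ X_[p]ᵀ e_l`, where `w` stands for the perturbed `μ̌`. -/
def integralI [NeZero p] (w : MatFunctional q p) (B : ℕ → Fin q → ℂ[X]) (i l : ℕ) : ℂ :=
  pairing w (B i) (mono p l)

/-- The determinant of `(𝕀_{i,l})`, `0 ≤ i, l ≤ n`. -/
def tauGram [NeZero p] (w : MatFunctional q p) (B : ℕ → Fin q → ℂ[X]) (n : ℕ) : ℂ :=
  Matrix.det (Matrix.of fun i l : Fin (n + 1) => integralI w B i l)

/-- The determinant with rows `𝔻_m - 𝕎_m`, `m = n - d + 1, …, n`, where `d = deg det R` and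
`d ≤ n + 1`. -/
def tauDW (μ : Fin q → Fin p → MeasureTheory.Measure ℝ) (J : JordanData R)
    (ξ : (i : Fin J.M) → Fin (J.s i) → ℕ → ℂ → Fin q → ℂ)
    (B : ℕ → Fin q → ℂ[X]) (d n : ℕ) : ℂ :=
  Matrix.det (Matrix.of fun m c : Fin J.size => rowDW μ J ξ B (n + 1 - d + m) c)

/-- The `τ`-determinants for all `n ≥ 0`, where `d = deg det R`. -/
def tau [NeZero p] (μ : Fin q → Fin p → MeasureTheory.Measure ℝ) (J : JordanData R)
    (ξ : (i : Fin J.M) → Fin (J.s i) → ℕ → ℂ → Fin q → ℂ)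
    (B : ℕ → Fin q → ℂ[X]) (d n : ℕ) : ℂ :=
  if n + 1 < d then tauGram (geronimus μ J ξ) B n else tauDW μ J ξ B d n

end Perturbation

end MixedGeronimus

end

open MixedGeronimus

/-! Write `d = N p - r`, let `w` be the functional of the perturbed measures, `u` that of the
original ones, and let `I` be the infinite matrix of the integrals `I_{n,l}`.

By Gauss–Borel factorization, orthogonality for a matrix functional exists exactly when all leading
minors of its moment matrix are nonzero. Replacing the monomial rows by the `B_n` is a unitriangular
change of basis, so for `w` these minors are the `tauGram` (`orthogonalityExists_iff_tauGram`). It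
remains to compare `tauGram` with `tauDW` once `n + 1 ≥ d`.

Reduction to `d × d` minors. Since `w(P, R Q) = u(P, Q)`, the vectors `R A_j` satisfy `w(B_i, R A_j)
= δ_{ij}`. The normalization of `R` puts the last step-line coefficient of `R A_j` at position `j +
d`, and it is nonzero. Hence a triangular change of columns turns the columns `d, d + 1, …` of `I`
into unit vectors, and a large leading minor vanishes exactly when the block of its last `d` rows
and first `d` columns is singular (`tauGram_ne_zero_iff`).

Jordan chains. Apply `w` in `t` to `B_n(t) (R(z) - R(t)) / (z - t)`. The divided difference is a
combination of the first `d` step-line monomials in `t`, with the rows `tailRow R e` as coefficients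
in `z`; evaluating it by Cauchy transforms gives `-D_n(z)`, the mass term of `W_n`, and an analytic
multiple of `R(z)`. Right chains annihilate that multiple, so `D_n - W_n = -(I_{n,0}, …, I_{n,d-1})
K`, where `K` collects the chain values of the tail rows (`HasLeadingForm.entryD_sub_entryW`).

Nonsingularity of `K`. Independence of the leading chain vectors allows Hermite interpolation along
all chains at once. Tail rows and polynomial multiples of rows of `R` span all row polynomials, and
the chains kill the latter, so the tail rows alone already reach every interpolation datum
(`HasLeadingForm.det_chainEval_ne_zero`). -/

noncomputable section

namespace MixedGeronimus

/-! ### Step-line coordinates of vector polynomials -/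

section StepLine

variable {r : ℕ} [NeZero r]

/-- The coefficient of `mono r k` in a vector polynomial. -/
def stepCoeff (k : ℕ) : (Fin r → ℂ[X]) →ₗ[ℂ] ℂ :=
  Polynomial.lcoeff ℂ (k / r) ∘ₗ LinearMap.proj (Fin.ofNat r k)

lemma stepCoeff_apply (k : ℕ) (Q : Fin r → ℂ[X]) :
    stepCoeff k Q = (Q (Fin.ofNat r k)).coeff (k / r) := rfl

lemma ofNat_add_mul (a : Fin r) (m : ℕ) : Fin.ofNat r (a + r * m) = a := by
  ext; simp [Fin.ofNat, Nat.mod_eq_of_lt a.2]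

lemma add_mul_div (a : Fin r) (m : ℕ) : ((a : ℕ) + r * m) / r = m := by
  rw [Nat.add_mul_div_left _ _ (NeZero.pos r), Nat.div_eq_of_lt a.2, zero_add]

lemma stepCoeff_add_mul (a : Fin r) (m : ℕ) (Q : Fin r → ℂ[X]) :
    stepCoeff ((a : ℕ) + r * m) Q = (Q a).coeff m := by
  rw [stepCoeff_apply, ofNat_add_mul, add_mul_div]

lemma stepCoeff_ext {P Q : Fin r → ℂ[X]} (h : ∀ k, stepCoeff k P = stepCoeff k Q) : P = Q := by
  ext a m
  simpa only [stepCoeff_add_mul] using h (a + r * m)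

lemma stepCoeff_mono (k l : ℕ) : stepCoeff k (mono r l) = if k = l then 1 else 0 := by
  rw [stepCoeff_apply, mono, Pi.single_apply]
  split_ifs with h1 h2 h2
  · simp [h2]
  · rw [coeff_X_pow, if_neg]
    intro h3
    have h4 : k % r = l % r := by simpa [Fin.ofNat, Fin.ext_iff] using h1
    exact h2 (by rw [← Nat.div_add_mod k r, ← Nat.div_add_mod l r, h3, h4])
  · exact absurd (by rw [h2]) h1
  · simp

lemma eq_sum_mono {Q : Fin r → ℂ[X]} {n : ℕ} (h : ∀ k, n ≤ k → stepCoeff k Q = 0) :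
    Q = ∑ k ∈ Finset.range n, stepCoeff k Q • mono r k := by
  refine stepCoeff_ext fun k => ?_
  simp only [map_sum, map_smul, stepCoeff_mono, smul_eq_mul, mul_ite, mul_one, mul_zero,
    Finset.sum_ite_eq, Finset.mem_range]
  split_ifs with hk
  · rfl
  · exact h k (not_lt.1 hk)

end StepLine

section Pairing

variable {q p : ℕ}

/-- The pairing as a bilinear map, for a matrix of linear functionals. -/
def pairingLin (w : Fin q → Fin p → ℂ[X] →ₗ[ℂ] ℂ) :
    (Fin q → ℂ[X]) →ₗ[ℂ] (Fin p → ℂ[X]) →ₗ[ℂ] ℂ :=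
  LinearMap.mk₂ ℂ (pairing fun b a => w b a)
    (fun _ _ _ => by simp [pairing, add_mul, Finset.sum_add_distrib])
    (fun _ _ _ => by simp [pairing, Finset.mul_sum])
    (fun _ _ _ => by simp [pairing, mul_add, Finset.sum_add_distrib])
    (fun _ _ _ => by simp [pairing, Finset.mul_sum])

lemma pairingLin_apply (w : Fin q → Fin p → ℂ[X] →ₗ[ℂ] ℂ) (P : Fin q → ℂ[X])
    (Q : Fin p → ℂ[X]) : pairingLin w P Q = pairing (fun b a => w b a) P Q := rfl

end Pairing

/-! ### Triangular changes of basis and Gauss–Borel factorization -/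

section Triangular

/-- Truncation of the lower triangular part of an infinite matrix. -/
def lowerTrunc (S : ℕ → ℕ → ℂ) (n : ℕ) : Matrix (Fin n) (Fin n) ℂ :=
  Matrix.of fun i k => if k ≤ i then S i k else 0

/-- Truncation of the upper triangular part of an infinite matrix. -/
def upperTrunc (U : ℕ → ℕ → ℂ) (n : ℕ) : Matrix (Fin n) (Fin n) ℂ :=
  Matrix.of fun k i => if k ≤ i then U k i else 0

lemma det_lowerTrunc (S : ℕ → ℕ → ℂ) (n : ℕ) : (lowerTrunc S n).det = ∏ i : Fin n, S i i := by
  rw [Matrix.det_of_isLowerTriangular]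
  · simp [lowerTrunc]
  · intro i j hij
    exact if_neg (not_le.2 (OrderDual.toDual_lt_toDual.1 hij))

lemma det_upperTrunc (U : ℕ → ℕ → ℂ) (n : ℕ) : (upperTrunc U n).det = ∏ i : Fin n, U i i := by
  rw [Matrix.det_of_isUpperTriangular]
  · simp [upperTrunc]
  · intro i j hij
    exact if_neg (not_le.2 hij)

lemma sum_range_eq_sum_fin {M : Type*} [AddCommMonoid M] {n : ℕ} (i : Fin n) (f : ℕ → M) :
    ∑ k ∈ Finset.range (i + 1), f k = ∑ k : Fin n, if k ≤ i then f k else 0 := by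
  refine Eq.trans ?_ (Fin.sum_univ_eq_sum_range (fun k => if k ≤ (i : ℕ) then f k else 0) n).symm
  rw [← Finset.sum_filter]
  refine Finset.sum_congr ?_ fun _ _ => rfl
  ext k
  simp only [Finset.mem_range, Finset.mem_filter]
  omega

/-- The leading `n × n` minor of an infinite matrix. -/
def leadingMinor (G : ℕ → ℕ → ℂ) (n : ℕ) : ℂ :=
  Matrix.det (Matrix.of fun i l : Fin n => G i l)

lemma gram_eq_mul {V W : Type*} [AddCommGroup V] [Module ℂ V] [AddCommGroup W] [Module ℂ W]
    (P : V →ₗ[ℂ] W →ₗ[ℂ] ℂ) {e B : ℕ → V} {f A : ℕ → W} {S U : ℕ → ℕ → ℂ}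
    (hB : ∀ n, B n = ∑ k ∈ Finset.range (n + 1), S n k • e k)
    (hA : ∀ n, A n = ∑ k ∈ Finset.range (n + 1), U k n • f k) (n : ℕ) :
    (Matrix.of fun i l : Fin n => P (B i) (A l)) =
      lowerTrunc S n * (Matrix.of fun i l : Fin n => P (e i) (f l)) * upperTrunc U n := by
  ext i l
  simp only [Matrix.of_apply, hB, hA, Matrix.mul_apply, lowerTrunc, upperTrunc]
  rw [sum_range_eq_sum_fin l (fun k => U k l • f k), sum_range_eq_sum_fin i (fun k => S i k • e k)]
  simp only [map_sum, LinearMap.sum_apply]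
  refine Finset.sum_congr rfl fun k _ => ?_
  rw [Finset.sum_mul]
  refine Finset.sum_congr rfl fun k' _ => ?_
  split_ifs <;> simp
  ring

lemma leadingMinor_gram {V W : Type*} [AddCommGroup V] [Module ℂ V] [AddCommGroup W] [Module ℂ W]
    (P : V →ₗ[ℂ] W →ₗ[ℂ] ℂ) {e B : ℕ → V} {f A : ℕ → W} {S U : ℕ → ℕ → ℂ}
    (hB : ∀ n, B n = ∑ k ∈ Finset.range (n + 1), S n k • e k)
    (hA : ∀ n, A n = ∑ k ∈ Finset.range (n + 1), U k n • f k) (n : ℕ) :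
    leadingMinor (fun i l => P (B i) (A l)) n =
      (∏ i : Fin n, S i i) * leadingMinor (fun i l => P (e i) (f l)) n * ∏ i : Fin n, U i i := by
  rw [leadingMinor, gram_eq_mul P hB hA, Matrix.det_mul, Matrix.det_mul, det_lowerTrunc,
    det_upperTrunc, leadingMinor]

/-- Gauss–Borel: nonvanishing leading minors give a biorthogonal pair of triangular bases. -/
lemma exists_biorthogonal {V W : Type*} [AddCommGroup V] [Module ℂ V] [AddCommGroup W]
    [Module ℂ W] (P : V →ₗ[ℂ] W →ₗ[ℂ] ℂ) (e : ℕ → V) (f : ℕ → W)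
    (h : ∀ n, leadingMinor (fun i l => P (e i) (f l)) n ≠ 0) :
    ∃ S U : ℕ → ℕ → ℂ, (∀ n, S n n = 1) ∧ (∀ n, U n n ≠ 0) ∧
      ∀ n m, P (∑ k ∈ Finset.range (n + 1), S n k • e k)
        (∑ k ∈ Finset.range (m + 1), U k m • f k) = if n = m then 1 else 0 := by
  -- left kernels and right kernels of the truncations are trivial
  have hleft : ∀ n, ∀ v : Fin n → ℂ, (∀ l : Fin n, ∑ k : Fin n, v k * P (e k) (f l) = 0) → v = 0 := by
    intro n v hv
    exact Matrix.eq_zero_of_vecMul_eq_zero (h n) (by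
      ext l; simpa [Matrix.vecMul, dotProduct] using hv l)
  have hright : ∀ n, ∀ v : Fin n → ℂ, (∀ i : Fin n, ∑ k : Fin n, P (e i) (f k) * v k = 0) → v = 0 := by
    intro n v hv
    exact Matrix.eq_zero_of_mulVec_eq_zero (h n) (by
      ext l; simpa [Matrix.mulVec, dotProduct] using hv l)
  -- The coefficients solve a linear system whose right-hand side is the last unit vector, then are
  -- scaled to be monic. The last entry is nonzero because otherwise the preceding minor would have
  -- a kernel.
  have hS : ∀ n, ∃ s : ℕ → ℂ, s n = 1 ∧
      ∀ l < n, P (∑ k ∈ Finset.range (n + 1), s k • e k) (f l) = 0 := by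
    intro n
    obtain ⟨v, hv⟩ := ((Matrix.vecMul_surjective_iff_isUnit
      (A := Matrix.of fun i l : Fin (n + 1) => P (e i) (f l))).2
      ((Matrix.isUnit_iff_isUnit_det _).2 (isUnit_iff_ne_zero.2 (h (n + 1)))))
      (Pi.single (Fin.last n) 1)
    have hv' : ∀ l : Fin (n + 1), ∑ k : Fin (n + 1), v k * P (e k) (f l) = if l = Fin.last n then 1 else 0 := by
      intro l
      have := congrFun hv l
      simpa [Matrix.vecMul, dotProduct, Pi.single_apply] using this
    have hne : v (Fin.last n) ≠ 0 := by
      intro h0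
      have h1 : (fun k : Fin n => v k.castSucc) = 0 := by
        refine hleft n _ fun l => ?_
        have := hv' l.castSucc
        rw [Fin.sum_univ_castSucc, h0, zero_mul, add_zero, if_neg (Fin.castSucc_lt_last l).ne]
          at this
        simpa using this
      have h2 := hv' (Fin.last n)
      rw [Fin.sum_univ_castSucc, h0, zero_mul, add_zero, if_pos rfl,
        Finset.sum_eq_zero fun k _ => by rw [show v k.castSucc = 0 from congrFun h1 k, zero_mul]]
        at h2
      exact zero_ne_one h2
    -- `Fin.ofNat` merely extends `v` to all of `ℕ`; only indices up to `n` are used.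
    refine ⟨fun k => (v (Fin.last n))⁻¹ * v (Fin.ofNat _ k), ?_, fun l hl => ?_⟩
    · have : Fin.ofNat (n + 1) n = Fin.last n := by ext; simp [Fin.ofNat]
      simp only [this, inv_mul_cancel₀ hne]
    · rw [Finset.sum_range fun k => ((v (Fin.last n))⁻¹ * v (Fin.ofNat _ k)) • e k]
      have := hv' ⟨l, by omega⟩
      rw [if_neg (by simp only [Fin.ext_iff, Fin.val_last]; omega)] at this
      simp only [map_sum, LinearMap.sum_apply, map_smul, LinearMap.smul_apply, smul_eq_mul,
        mul_assoc, ← Finset.mul_sum, Fin.ofNat_eq_cast, Fin.cast_val_eq_self]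
      rw [this, mul_zero]
  -- No rescaling on this side: the value `1` at `e m` is what normalizes the biorthogonality, given
  -- that `S` is monic.
  have hU : ∀ m, ∃ u : ℕ → ℂ, u m ≠ 0 ∧ ∀ i ≤ m,
      P (e i) (∑ k ∈ Finset.range (m + 1), u k • f k) = if i = m then 1 else 0 := by
    intro n
    obtain ⟨v, hv⟩ := ((Matrix.mulVec_surjective_iff_isUnit
      (A := Matrix.of fun i l : Fin (n + 1) => P (e i) (f l))).2
      ((Matrix.isUnit_iff_isUnit_det _).2 (isUnit_iff_ne_zero.2 (h (n + 1)))))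
      (Pi.single (Fin.last n) 1)
    have hv' : ∀ l : Fin (n + 1), ∑ k : Fin (n + 1), P (e l) (f k) * v k = if l = Fin.last n then 1 else 0 := by
      intro l
      have := congrFun hv l
      simpa [Matrix.mulVec, dotProduct, Pi.single_apply] using this
    refine ⟨fun k => v (Fin.ofNat _ k), ?_, fun l hl => ?_⟩
    · have : Fin.ofNat (n + 1) n = Fin.last n := by ext; simp [Fin.ofNat]
      simp only [this]
      intro h0
      have h1 : (fun k : Fin n => v k.castSucc) = 0 := by
        refine hright n _ fun l => ?_
        have := hv' l.castSucc
        rw [Fin.sum_univ_castSucc, h0, mul_zero, add_zero, if_neg (Fin.castSucc_lt_last l).ne]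
          at this
        simpa using this
      have h2 := hv' (Fin.last n)
      rw [Fin.sum_univ_castSucc, h0, mul_zero, add_zero, if_pos rfl,
        Finset.sum_eq_zero fun k _ => by rw [show v k.castSucc = 0 from congrFun h1 k, mul_zero]]
        at h2
      exact zero_ne_one h2
    · rw [Finset.sum_range fun k => v (Fin.ofNat _ k) • f k]
      have := hv' ⟨l, by omega⟩
      simp only [Fin.ext_iff, Fin.val_last] at this
      rw [← this]
      simp [map_sum, mul_comm]
  choose S hS1 hS2 using hS
  choose U hU1 hU2 using hU
  refine ⟨S, fun k m => U m k, hS1, hU1, fun n m => ?_⟩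
  -- Below the diagonal of the index pair the right vector kills every `e k` with `k < m`; above it
  -- the left vector kills every `f k` with `k < n`; on it only the monic top term survives.
  rcases lt_trichotomy n m with hnm | rfl | hnm
  · rw [if_neg hnm.ne, map_sum P, LinearMap.sum_apply]
    refine Finset.sum_eq_zero fun k hk => ?_
    have hk' := Finset.mem_range.1 hk
    rw [map_smul, LinearMap.smul_apply, hU2 m k (by omega), if_neg (by omega), smul_zero]
  · rw [if_pos rfl, map_sum P, LinearMap.sum_apply, Finset.sum_range_succ, Finset.sum_eq_zero]
    · rw [map_smul, LinearMap.smul_apply, hU2 n n le_rfl, if_pos rfl, hS1]; simp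
    · intro k hk
      have hk' := Finset.mem_range.1 hk
      rw [map_smul, LinearMap.smul_apply, hU2 n k (by omega), if_neg (by omega), smul_zero]
  · rw [if_neg hnm.ne', map_sum]
    refine Finset.sum_eq_zero fun k hk => ?_
    have hk' := Finset.mem_range.1 hk
    rw [map_smul, hS2 n k (by omega), smul_zero]

end Triangular

/-! ### Existence of orthogonality in terms of minors -/

section Existence

variable {q p : ℕ} [NeZero q] [NeZero p]

theorem orthogonalityExists_iff (w : Fin q → Fin p → ℂ[X] →ₗ[ℂ] ℂ) :
    OrthogonalityExists (fun b a => w b a) ↔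
      ∀ n, leadingMinor (fun i l => pairingLin w (mono q i) (mono p l)) n ≠ 0 := by
  constructor
  · rintro ⟨B, A, ⟨S, hS⟩, ⟨U, hU⟩, h⟩ n h0
    have h1 := leadingMinor_gram (pairingLin w) (fun n => (hS n).2) (fun n => (hU n).2) n
    rw [h0, mul_zero, zero_mul] at h1
    have h2 : (Matrix.of fun i l : Fin n => pairingLin w (B i) (A l)) = 1 := by
      ext i l
      simp [pairingLin_apply, h, Matrix.one_apply, Fin.ext_iff]
    rw [leadingMinor, h2, Matrix.det_one] at h1
    exact one_ne_zero h1
  · intro h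
    obtain ⟨S, U, hS, hU, hSU⟩ := exists_biorthogonal (pairingLin w) (mono q) (mono p) h
    exact ⟨_, _, ⟨S, fun n => ⟨hS n, rfl⟩⟩, ⟨U, fun n => ⟨hU n, rfl⟩⟩, hSU⟩

/-- Only the left basis changes, and by a unitriangular matrix, so the minors agree exactly and not
just up to a factor. -/
lemma tauGram_eq (w : Fin q → Fin p → ℂ[X] →ₗ[ℂ] ℂ) {B : ℕ → Fin q → ℂ[X]} {S : ℕ → ℕ → ℂ}
    (hS : ∀ n, S n n = 1 ∧ B n = ∑ k ∈ Finset.range (n + 1), S n k • mono q k) (n : ℕ) :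
    tauGram (fun b a => w b a) B n =
      leadingMinor (fun i l => pairingLin w (mono q i) (mono p l)) (n + 1) := by
  have h := leadingMinor_gram (pairingLin w) (fun n => (hS n).2) (f := mono p) (A := mono p)
    (U := fun k n => if k = n then 1 else 0) (fun n => by simp) (n + 1)
  simp only [fun n => (hS n).1, Finset.prod_const_one, one_mul, if_true, mul_one] at h
  exact h

theorem orthogonalityExists_iff_tauGram (w : Fin q → Fin p → ℂ[X] →ₗ[ℂ] ℂ)
    {B : ℕ → Fin q → ℂ[X]} {S : ℕ → ℕ → ℂ}
    (hS : ∀ n, S n n = 1 ∧ B n = ∑ k ∈ Finset.range (n + 1), S n k • mono q k) :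
    OrthogonalityExists (fun b a => w b a) ↔ ∀ n, tauGram (fun b a => w b a) B n ≠ 0 := by
  simp only [orthogonalityExists_iff, tauGram_eq w hS]
  refine ⟨fun h n => h _, fun h n => ?_⟩
  cases n with
  | zero => simp [leadingMinor]
  | succ n => exact h n

end Existence

/-! ### Reduction of large minors to minors with `d` columns -/

section Shift

/-- If the columns `d, d + 1, …` of `I` become unit vectors after an upper triangular change of
columns, then its leading minors reduce to minors of its first `d` columns. -/
lemma leadingMinor_ne_zero_iff (I T : ℕ → ℕ → ℂ) (d s : ℕ) (hT : ∀ j, T (j + d) j ≠ 0)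
    (hI : ∀ i j, ∑ k ∈ Finset.range (j + d + 1), I i k * T k j = if i = j then 1 else 0) :
    leadingMinor I (s + d) ≠ 0 ↔
      Matrix.det (Matrix.of fun m e : Fin d => I (s + m) e) ≠ 0 := by
  -- `T` completed by the identity in the first `d` columns, which leaves those columns of `I`
  -- untouched.
  let T' : ℕ → ℕ → ℂ := fun k l => if l < d then (if k = l then 1 else 0) else T k (l - d)
  have hdet : (upperTrunc T' (s + d)).det ≠ 0 := by
    rw [det_upperTrunc, Finset.prod_ne_zero_iff]
    intro i _
    simp only [T']
    split_ifs with h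
    · exact one_ne_zero
    · have := hT (i - d)
      rwa [Nat.sub_add_cancel (not_lt.1 h)] at this
  have hM : ∀ i l : Fin (s + d), ((Matrix.of fun i l : Fin (s + d) => I i l) *
      upperTrunc T' (s + d)) i l = if (l : ℕ) < d then I i l else
        if (i : ℕ) + d = l then 1 else 0 := by
    intro i l
    have h1 : ((Matrix.of fun i l : Fin (s + d) => I i l) * upperTrunc T' (s + d)) i l =
        ∑ k ∈ Finset.range (l + 1), I i k * T' k l := by
      rw [sum_range_eq_sum_fin l (fun k => I i k * T' k l), Matrix.mul_apply]
      refine Finset.sum_congr rfl fun k _ => ?_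
      simp [upperTrunc]
    rw [h1]
    simp only [T']
    split_ifs with h2 h3
    · simp
    · have := hI i i
      rw [if_pos rfl, h3] at this
      rwa [show (l : ℕ) - d = i by omega]
    · have := hI i (l - d)
      rwa [if_neg (by omega), show (l : ℕ) - d + d = l by omega] at this
  -- Moving the first `d` columns to the end gives a block upper triangular matrix: an identity
  -- block from the unit columns, and the wanted minor in the last `d` rows.
  have key : ((Matrix.of fun i l : Fin (s + d) => I i l) * upperTrunc T' (s + d)).submatrix
      finSumFinEquiv ((Equiv.sumComm _ _).trans (finSumFinEquiv.trans (finCongr (add_comm d s)))) =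
      Matrix.fromBlocks 1 (Matrix.of fun (i : Fin s) (e : Fin d) => I i e) 0
        (Matrix.of fun m e : Fin d => I (s + m) e) := by
    ext i l
    rw [Matrix.submatrix_apply, hM]
    rcases i with i | i <;> rcases l with l | l <;>
      simp [Matrix.one_apply, Fin.ext_iff]
    · omega
  have h2 := Matrix.isUnit_submatrix_equiv
    (A := (Matrix.of fun i l : Fin (s + d) => I i l) * upperTrunc T' (s + d)) finSumFinEquiv
    ((Equiv.sumComm _ _).trans (finSumFinEquiv.trans (finCongr (add_comm d s))))
  rw [key, Matrix.isUnit_iff_isUnit_det, Matrix.isUnit_iff_isUnit_det,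
    Matrix.det_fromBlocks_zero₂₁, Matrix.det_one, one_mul, Matrix.det_mul, isUnit_iff_ne_zero,
    isUnit_iff_ne_zero] at h2
  rw [h2]
  simp [leadingMinor, hdet]

variable {p : ℕ} [NeZero p] {R : Matrix (Fin p) (Fin p) ℂ[X]} {N r : ℕ}

/-- Write `l = a' + p c'`. If `a' ≥ r`, the top term comes from `R_N`, in component `a' - r` with
exponent `c' + N`. If `a' < r`, that column of `R_N` is zero and `R_{N-1}` gives component `a' + p -
r` with exponent `c' + N - 1`. Both are position `l + N p - r`. -/
lemma HasLeadingForm.stepCoeff_mulVec_mono (hR : HasLeadingForm R N r) (hN : 1 ≤ N) (hr : r < p)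
    {k l : ℕ} (hk : l + (N * p - r) ≤ k) :
    stepCoeff k (R *ᵥ mono p l) = if k = l + (N * p - r) then 1 else 0 := by
  have hp : 0 < p := NeZero.pos p
  have hNp : p ≤ N * p := Nat.le_mul_of_pos_left p hN
  obtain ⟨N, rfl⟩ : ∃ n, N = n + 1 := ⟨N - 1, by omega⟩
  obtain ⟨a, c, rfl⟩ : ∃ (a : Fin p) (c : ℕ), k = a + p * c :=
    ⟨⟨k % p, Nat.mod_lt _ hp⟩, k / p, (Nat.mod_add_div k p).symm⟩
  obtain ⟨a', c', rfl⟩ : ∃ (a : Fin p) (c : ℕ), l = a + p * c :=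
    ⟨⟨l % p, Nat.mod_lt _ hp⟩, l / p, (Nat.mod_add_div l p).symm⟩
  have ha := a.2
  have ha' := a'.2
  have hcc : c' + N ≤ c := by
    by_contra hlt
    have h1 : p * (c + 1) ≤ p * (c' + N) := Nat.mul_le_mul_left p (by omega)
    have h2 : (N + 1) * p = p * N + p := by ring
    rw [mul_add, mul_add, mul_one] at h1
    omega
  obtain ⟨e, rfl⟩ := Nat.exists_eq_add_of_le hcc
  rw [stepCoeff_add_mul, mono, ofNat_add_mul, add_mul_div, Matrix.mulVec_single]
  have h2 : (N + 1) * p = p * N + p := by ring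
  have h3 : p * (c' + N + e) = p * c' + p * N + p * e := by ring
  simp only [Matrix.col_apply, Pi.smul_apply, MulOpposite.smul_eq_mul_unop,
    MulOpposite.unop_op, h3] at hk ⊢
  rw [show c' + N + e = (N + e) + c' by ring, coeff_mul_X_pow]
  -- After `N` was replaced by `N + 1`, these cases read off the subleading coefficient, the leading
  -- one, and coefficients beyond the degree. In the first, `hk` forces the lower left block.
  rcases e with _ | _ | e
  · have h4 := hR.subleading a a' (by omega) (by omega)
    rw [Nat.add_sub_cancel] at h4
    rw [add_zero, h4]
    congr 1
    rw [eq_iff_iff]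
    omega
  · rw [zero_add, hR.leading]
    congr 1
    rw [eq_iff_iff]
    omega
  · have h5 : p * (e + 1 + 1) = p * e + p + p := by ring
    rw [coeff_eq_zero_of_natDegree_lt (lt_of_le_of_lt (hR.natDegree_le a a') (by omega)),
      if_neg]
    have := Nat.zero_le (p * e)
    omega

/-- Multiplication by `R` raises the position on the step line by `N p - r`. -/
lemma HasLeadingForm.stepCoeff_mulVec (hR : HasLeadingForm R N r) (hN : 1 ≤ N) (hr : r < p)
    {U : ℕ → ℂ} {j k : ℕ} (hk : j + (N * p - r) ≤ k) :
    stepCoeff k (R *ᵥ ∑ l ∈ Finset.range (j + 1), U l • mono p l) =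
      if k = j + (N * p - r) then U j else 0 := by
  have h1 : R *ᵥ ∑ l ∈ Finset.range (j + 1), U l • mono p l =
      ∑ l ∈ Finset.range (j + 1), U l • (R *ᵥ mono p l) := by
    rw [Matrix.mulVec_sum]
    exact Finset.sum_congr rfl fun l _ => Matrix.mulVec_smul _ _ _
  rw [h1, map_sum, Finset.sum_congr rfl fun l hl => by
    rw [map_smul, hR.stepCoeff_mulVec_mono hN hr
      (le_trans (by have := Finset.mem_range.1 hl; omega) hk)], Finset.sum_range_succ,
    Finset.sum_eq_zero]
  · simp
  · intro l hl
    have := Finset.mem_range.1 hl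
    rw [if_neg (by omega), smul_zero]

variable {q : ℕ} [NeZero q]

/-- The triangular change of columns consists of the step-line coefficients of `R A_j`, which pair
with `B_i` under `w` as `A_j` does under `u`. -/
theorem tauGram_ne_zero_iff (hR : HasLeadingForm R N r) (hN : 1 ≤ N) (hr : r < p)
    {u w : Fin q → Fin p → ℂ[X] →ₗ[ℂ] ℂ}
    (hw : ∀ P Q, pairingLin w P (R *ᵥ Q) = pairingLin u P Q)
    {B : ℕ → Fin q → ℂ[X]} {A : ℕ → Fin p → ℂ[X]}
    (hBA : IsMixedOrthogonal (fun b a => u b a) B A) {n : ℕ} (hn : N * p - r ≤ n + 1) :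
    tauGram (fun b a => w b a) B n ≠ 0 ↔
      Matrix.det (Matrix.of fun m e : Fin (N * p - r) =>
        integralI (fun b a => w b a) B (n + 1 - (N * p - r) + m) e) ≠ 0 := by
  obtain ⟨U, hU⟩ := hBA.exists_U
  rw [← leadingMinor_ne_zero_iff (integralI (fun b a => w b a) B)
    (fun k j => stepCoeff k (R *ᵥ A j)) (N * p - r) (n + 1 - (N * p - r)),
    Nat.sub_add_cancel hn]
  · rfl
  · intro j
    rw [(hU j).2, hR.stepCoeff_mulVec hN hr (U := fun k => U k j) le_rfl, if_pos rfl]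
    exact (hU j).1
  · intro i j
    rw [← hBA.biorthogonal i j, ← pairingLin_apply, ← hw]
    conv_rhs => rw [eq_sum_mono (Q := R *ᵥ A j) (n := j + (N * p - r) + 1) (by
      intro k hk
      rw [(hU j).2, hR.stepCoeff_mulVec hN hr (U := fun k => U k j) (by omega),
        if_neg (by omega)])]
    simp [map_sum, mul_comm, integralI, pairingLin_apply]

end Shift

/-! ### Taylor series as formal power series -/

section Taylor

/-- The Taylor series of `f` at `x`, as a formal power series. -/
def taylorSeries (f : ℂ → ℂ) (x : ℂ) : PowerSeries ℂ :=
  PowerSeries.mk fun l => (l.factorial : ℂ)⁻¹ * iteratedDeriv l f x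

lemma coeff_taylorSeries (f : ℂ → ℂ) (x : ℂ) (l : ℕ) :
    PowerSeries.coeff l (taylorSeries f x) = (l.factorial : ℂ)⁻¹ * iteratedDeriv l f x :=
  PowerSeries.coeff_mk _ _

variable {f g : ℂ → ℂ} {x : ℂ}

lemma taylorSeries_congr (h : f =ᶠ[𝓝 x] g) : taylorSeries f x = taylorSeries g x := by
  ext l
  rw [coeff_taylorSeries, coeff_taylorSeries, h.iteratedDeriv_eq]

lemma taylorSeries_mul (hf : AnalyticAt ℂ f x) (hg : AnalyticAt ℂ g x) :
    taylorSeries (fun t => f t * g t) x = taylorSeries f x * taylorSeries g x := by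
  ext l
  rw [PowerSeries.coeff_mul, coeff_taylorSeries, iteratedDeriv_fun_mul hf.contDiffAt hg.contDiffAt,
    Finset.Nat.sum_antidiagonal_eq_sum_range_succ fun i j =>
      PowerSeries.coeff i (taylorSeries f x) * PowerSeries.coeff j (taylorSeries g x),
    Finset.mul_sum]
  refine Finset.sum_congr rfl fun i hi => ?_
  have hi' : i ≤ l := Nat.lt_succ_iff.1 (Finset.mem_range.1 hi)
  have h1 : (l.factorial : ℂ) ≠ 0 := Nat.cast_ne_zero.2 l.factorial_ne_zero
  have h2 : (i.factorial : ℂ) ≠ 0 := Nat.cast_ne_zero.2 i.factorial_ne_zero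
  have h3 : ((l - i).factorial : ℂ) ≠ 0 := Nat.cast_ne_zero.2 (l - i).factorial_ne_zero
  rw [coeff_taylorSeries, coeff_taylorSeries, Nat.cast_choose ℂ hi']
  field_simp

lemma taylorSeries_sum {ι : Type*} {s : Finset ι} {F : ι → ℂ → ℂ}
    (hF : ∀ i ∈ s, AnalyticAt ℂ (F i) x) :
    taylorSeries (fun t => ∑ i ∈ s, F i t) x = ∑ i ∈ s, taylorSeries (F i) x := by
  ext l
  rw [map_sum, coeff_taylorSeries, iteratedDeriv_fun_sum fun i hi => (hF i hi).contDiffAt,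
    Finset.mul_sum]
  simp only [coeff_taylorSeries]

lemma taylorSeries_add (hf : AnalyticAt ℂ f x) (hg : AnalyticAt ℂ g x) :
    taylorSeries (fun t => f t + g t) x = taylorSeries f x + taylorSeries g x := by
  ext l
  rw [map_add, coeff_taylorSeries, iteratedDeriv_fun_add hf.contDiffAt hg.contDiffAt, mul_add]
  simp only [coeff_taylorSeries]

lemma taylorSeries_const_mul (c : ℂ) :
    taylorSeries (fun t => c * f t) x = c • taylorSeries f x := by
  ext l
  rw [PowerSeries.coeff_smul, coeff_taylorSeries, coeff_taylorSeries,
    iteratedDeriv_const_mul_field, smul_eq_mul, mul_left_comm]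

lemma taylorSeries_sub (hf : AnalyticAt ℂ f x) (hg : AnalyticAt ℂ g x) :
    taylorSeries (fun t => f t - g t) x = taylorSeries f x - taylorSeries g x := by
  ext l
  rw [map_sub, coeff_taylorSeries, iteratedDeriv_fun_sub hf.contDiffAt hg.contDiffAt, mul_sub]
  simp only [coeff_taylorSeries]

lemma iteratedDeriv_eval (P : ℂ[X]) (l : ℕ) :
    iteratedDeriv l (fun t => P.eval t) = fun t => (derivative^[l] P).eval t := by
  induction l with
  | zero => simp
  | succ l ih =>
    rw [iteratedDeriv_succ, ih]
    ext t
    rw [Polynomial.deriv, Function.iterate_succ_apply']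

lemma analyticAt_eval (P : ℂ[X]) (x : ℂ) : AnalyticAt ℂ (fun t => P.eval t) x :=
  P.differentiable.analyticAt x

lemma inv_factorial_mul_iterate_derivative (P : ℂ[X]) (l : ℕ) (x : ℂ) :
    (l.factorial : ℂ)⁻¹ * (derivative^[l] P).eval x = (taylor x P).coeff l := by
  have h1 : (l.factorial : ℂ) ≠ 0 := Nat.cast_ne_zero.2 l.factorial_ne_zero
  rw [taylor_coeff, ← factorial_smul_hasseDeriv, inv_mul_eq_iff_eq_mul₀ h1]
  simp

lemma taylorSeries_eval (P : ℂ[X]) (x : ℂ) :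
    taylorSeries (fun t => P.eval t) x = (taylor x P : ℂ[X]) := by
  ext l
  rw [coeff_taylorSeries, iteratedDeriv_eval, coeff_coe, inv_factorial_mul_iterate_derivative]

/-- Both sides are inverses of the power series `(z - x) - X`. -/
lemma taylorSeries_inv_sub {z : ℂ} (hz : z ≠ x) :
    taylorSeries (fun t => (z - t)⁻¹) x =
      PowerSeries.mk fun n => ((z - x) ^ (n + 1))⁻¹ := by
  have h0 : z - x ≠ 0 := sub_ne_zero.2 hz
  have h1 : AnalyticAt ℂ (fun t => z - t) x := by fun_prop
  have h2 : taylorSeries (fun t => z - t) x =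
      PowerSeries.C ((Units.mk0 _ h0 : ℂˣ) : ℂ) - PowerSeries.X := by
    have : (fun t => z - t) = fun t => (C z - X : ℂ[X]).eval t := by ext; simp
    rw [this, taylorSeries_eval]
    simp only [map_sub, taylor_C, taylor_X, Units.val_mk0]
    rw [Polynomial.coe_sub, Polynomial.coe_add, Polynomial.coe_C, Polynomial.coe_C,
      Polynomial.coe_X]
    ring
  have h3 : taylorSeries (fun t => (z - t)⁻¹) x * taylorSeries (fun t => z - t) x = 1 := by
    rw [← taylorSeries_mul (h1.fun_inv h0) h1]
    have : (fun t => (z - t)⁻¹ * (z - t)) =ᶠ[𝓝 x] fun t => (1 : ℂ[X]).eval t := by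
      filter_upwards [h1.continuousAt.eventually_ne h0] with t ht
      rw [inv_mul_cancel₀ ht, eval_one]
    rw [taylorSeries_congr this, taylorSeries_eval, taylor_one]
    simp
  have h4 : PowerSeries.invUnitsSub (Units.mk0 _ h0) * taylorSeries (fun t => z - t) x = 1 := by
    rw [h2, PowerSeries.invUnitsSub_mul_sub]
  have h5 : taylorSeries (fun t => (z - t)⁻¹) x = PowerSeries.invUnitsSub (Units.mk0 _ h0) :=
    mul_right_cancel₀ (right_ne_zero_of_mul_eq_one h3) (h3.trans h4.symm)
  rw [h5]
  ext n
  simp [PowerSeries.coeff_invUnitsSub]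

end Taylor

/-! ### Action of the Jordan chains -/

section Chains

variable {p : ℕ} {R : Matrix (Fin p) (Fin p) ℂ[X]}

/-- A chain of vectors as a vector of power series. -/
def chainSeries (v : ℕ → Fin p → ℂ) (a : Fin p) : PowerSeries ℂ := PowerSeries.mk fun k => v k a

lemma coeff_mul_chainSeries (φ : PowerSeries ℂ) (v : ℕ → Fin p → ℂ) (a : Fin p) (k : ℕ) :
    PowerSeries.coeff k (φ * chainSeries v a) =
      ∑ l ∈ Finset.range (k + 1), PowerSeries.coeff l φ * v (k - l) a := by
  rw [PowerSeries.coeff_mul, Finset.Nat.sum_antidiagonal_eq_sum_range_succ fun i j =>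
      PowerSeries.coeff i φ * PowerSeries.coeff j (chainSeries v a)]
  simp [chainSeries]

lemma coeff_mul_eq_zero {φ ψ : PowerSeries ℂ} {κ : ℕ}
    (h : ∀ k < κ, PowerSeries.coeff k ψ = 0) {k : ℕ} (hk : k < κ) :
    PowerSeries.coeff k (φ * ψ) = 0 :=
  PowerSeries.X_pow_dvd_iff.1 ((PowerSeries.X_pow_dvd_iff.2 h).mul_left φ) k hk

lemma coeff_sum_mul_eq_zero {φ : Fin p → PowerSeries ℂ} {ψ : Fin p → PowerSeries ℂ} {κ : ℕ}
    (h : ∀ a, ∀ k < κ, PowerSeries.coeff k (ψ a) = 0) {k : ℕ} (hk : k < κ) :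
    PowerSeries.coeff k (∑ a, φ a * ψ a) = 0 := by
  rw [map_sum]
  exact Finset.sum_eq_zero fun a _ => coeff_mul_eq_zero (h a) hk

/-- With the factors `1 / l!` absorbed in Taylor coefficients, the chain relations are a Cauchy
product: the expansion of `R` times the chain series vanishes modulo `X ^ κ j`, a condition stable
under multiplication by any power series. -/
lemma IsCanonicalRight.coeff_eq_zero {z : ℂ} {s : ℕ} {κ : Fin s → ℕ} {v : Fin s → ℕ → Fin p → ℂ}
    (h : IsCanonicalRight R z κ v) (j : Fin s) (a : Fin p) (k : ℕ) (hk : k < κ j) :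
    PowerSeries.coeff k
      (∑ a', ((taylor z (R a a') : ℂ[X]) : PowerSeries ℂ) * chainSeries (v j) a') = 0 := by
  have h1 := congrFun (h.chain j k hk) a
  rw [Finset.sum_apply] at h1
  simp only [map_sum, coeff_mul_chainSeries, coeff_coe, ← inv_factorial_mul_iterate_derivative]
  rw [Finset.sum_comm]
  refine (Finset.sum_congr rfl fun l _ => ?_).trans h1
  simp [Matrix.mulVec, dotProduct, derivAt, Finset.mul_sum, mul_assoc]

lemma IsCanonicalLeft.coeff_eq_zero {z : ℂ} {s : ℕ} {κ : Fin s → ℕ} {v : Fin s → ℕ → Fin p → ℂ}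
    (h : IsCanonicalLeft R z κ v) (j : Fin s) (a : Fin p) (k : ℕ) (hk : k < κ j) :
    PowerSeries.coeff k
      (∑ a', ((taylor z (R a' a) : ℂ[X]) : PowerSeries ℂ) * chainSeries (v j) a') = 0 := by
  have h1 := congrFun (h.chain j k hk) a
  rw [Finset.sum_apply] at h1
  simp only [map_sum, coeff_mul_chainSeries, coeff_coe, ← inv_factorial_mul_iterate_derivative]
  rw [Finset.sum_comm]
  refine (Finset.sum_congr rfl fun l _ => ?_).trans h1
  simp only [Matrix.vecMul, dotProduct, derivAt, Pi.smul_apply, smul_eq_mul, Finset.mul_sum,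
    Matrix.map_apply]
  exact Finset.sum_congr rfl fun _ _ => by ring

variable (J : JordanData R)

lemma chainAction_eq (i : Fin J.M) (j : Fin (J.s i)) (k : ℕ) (F : ℂ → Fin p → ℂ) (z : ℂ) :
    chainAction J i j k F z =
      PowerSeries.coeff k (∑ a, taylorSeries (fun y => F y a) z * chainSeries (J.vR i j) a) := by
  simp only [map_sum, coeff_mul_chainSeries, coeff_taylorSeries]
  rw [Finset.sum_comm, chainAction]
  simp [Finset.mul_sum, mul_assoc]

lemma chainAction_congr {i : Fin J.M} {j : Fin (J.s i)} {k : ℕ} {F G : ℂ → Fin p → ℂ} {z : ℂ}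
    (h : ∀ᶠ y in 𝓝 z, F y = G y) : chainAction J i j k F z = chainAction J i j k G z := by
  simp only [chainAction_eq]
  congr 1
  refine Finset.sum_congr rfl fun a _ => ?_
  rw [taylorSeries_congr (h.mono fun y hy => congrFun hy a)]

lemma chainAction_add {i : Fin J.M} {j : Fin (J.s i)} {k : ℕ} {F G : ℂ → Fin p → ℂ} {z : ℂ}
    (hF : ∀ a, AnalyticAt ℂ (fun y => F y a) z) (hG : ∀ a, AnalyticAt ℂ (fun y => G y a) z) :
    chainAction J i j k (fun y a => F y a + G y a) z =
      chainAction J i j k F z + chainAction J i j k G z := by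
  simp only [chainAction_eq, ← map_add, ← Finset.sum_add_distrib, ← add_mul]
  congr 1
  exact Finset.sum_congr rfl fun a _ => by rw [taylorSeries_add (hF a) (hG a)]

lemma chainAction_sub {i : Fin J.M} {j : Fin (J.s i)} {k : ℕ} {F G : ℂ → Fin p → ℂ} {z : ℂ}
    (hF : ∀ a, AnalyticAt ℂ (fun y => F y a) z) (hG : ∀ a, AnalyticAt ℂ (fun y => G y a) z) :
    chainAction J i j k (fun y a => F y a - G y a) z =
      chainAction J i j k F z - chainAction J i j k G z := by
  simp only [chainAction_eq, ← map_sub, ← Finset.sum_sub_distrib, ← sub_mul]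
  congr 1
  exact Finset.sum_congr rfl fun a _ => by rw [taylorSeries_sub (hF a) (hG a)]

lemma chainAction_sum {ι : Type*} {s : Finset ι} {c : ι → ℂ} {i : Fin J.M} {j : Fin (J.s i)}
    {k : ℕ} {F : ι → ℂ → Fin p → ℂ} {z : ℂ}
    (hF : ∀ e ∈ s, ∀ a, AnalyticAt ℂ (fun y => F e y a) z) :
    chainAction J i j k (fun y a => ∑ e ∈ s, c e * F e y a) z =
      ∑ e ∈ s, c e * chainAction J i j k (F e) z := by
  simp only [chainAction_eq]
  have h : ∀ a, taylorSeries (fun y => ∑ e ∈ s, c e * F e y a) z =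
      ∑ e ∈ s, c e • taylorSeries (fun y => F e y a) z := fun a => by
    rw [taylorSeries_sum fun e he => analyticAt_const.fun_mul (hF e he a)]
    exact Finset.sum_congr rfl fun e he => taylorSeries_const_mul _
  simp only [h, Finset.sum_mul, map_sum, smul_mul_assoc, PowerSeries.coeff_smul, smul_eq_mul,
    Finset.mul_sum]
  exact Finset.sum_comm

/-- The chains annihilate the analytic multiples of `R`. -/
lemma chainAction_mul_eq_zero {i : Fin J.M} {j : Fin (J.s i)} {k : ℕ} (hk : k < J.κ i j)
    {H : ℂ → Fin p → ℂ} (hH : ∀ a, AnalyticAt ℂ (fun y => H y a) (J.x i)) :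
    chainAction J i j k (fun y a' => ∑ a, H y a * (R a a').eval y) (J.x i) = 0 := by
  rw [chainAction_eq]
  have h : ∀ a', taylorSeries (fun y => ∑ a, H y a * (R a a').eval y) (J.x i) =
      ∑ a, taylorSeries (fun y => H y a) (J.x i) * (taylor (J.x i) (R a a') : ℂ[X]) := fun a' => by
    rw [taylorSeries_sum fun a _ => (hH a).fun_mul (analyticAt_eval _ _)]
    refine Finset.sum_congr rfl fun a _ => ?_
    rw [taylorSeries_mul (hH a) (analyticAt_eval _ _), taylorSeries_eval]
  simp only [h, Finset.sum_mul]
  rw [Finset.sum_comm]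
  simp only [mul_assoc, ← Finset.mul_sum]
  exact coeff_sum_mul_eq_zero (fun a k hk => (J.right i).coeff_eq_zero j a k hk) hk

lemma continuousAt_chainAction {i : Fin J.M} {j : Fin (J.s i)} {k : ℕ} {F : ℂ → Fin p → ℂ} {z : ℂ}
    (hF : ∀ a, AnalyticAt ℂ (fun y => F y a) z) : ContinuousAt (chainAction J i j k F) z := by
  unfold chainAction
  refine tendsto_finsetSum _ fun l _ => Filter.Tendsto.const_mul _ ?_
  refine tendsto_finsetSum _ fun a _ => Filter.Tendsto.mul_const _ ?_
  rw [iteratedDeriv_eq_iterate]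
  exact ((hF a).iterated_deriv l).continuousAt

/-- The action of the left chain on the vector functional with density `g` at `x_i`. -/
def leftAction (i : Fin J.M) (j : Fin (J.s i)) (k : ℕ) (g : ℂ → ℂ) (a : Fin p) : ℂ :=
  PowerSeries.coeff k (taylorSeries g (J.x i) * chainSeries (J.vL i j) a)

lemma leftAction_eq (i : Fin J.M) (j : Fin (J.s i)) (k : ℕ) (g : ℂ → ℂ) (a : Fin p) :
    leftAction J i j k g a = ∑ l ∈ Finset.range (k + 1),
      ((l.factorial : ℂ)⁻¹) * iteratedDeriv l g (J.x i) * J.vL i j (k - l) a := by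
  simp only [leftAction, coeff_mul_chainSeries, coeff_taylorSeries]

lemma leftAction_congr {i : Fin J.M} {j : Fin (J.s i)} {k : ℕ} {g g' : ℂ → ℂ}
    (h : g =ᶠ[𝓝 (J.x i)] g') (a : Fin p) : leftAction J i j k g a = leftAction J i j k g' a := by
  rw [leftAction, taylorSeries_congr h, leftAction]

lemma leftAction_sum {ι : Type*} {s : Finset ι} {i : Fin J.M} {j : Fin (J.s i)} {k : ℕ}
    {F : ι → ℂ → ℂ} (hF : ∀ e ∈ s, AnalyticAt ℂ (F e) (J.x i)) (a : Fin p) :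
    leftAction J i j k (fun t => ∑ e ∈ s, F e t) a = ∑ e ∈ s, leftAction J i j k (F e) a := by
  simp only [leftAction, taylorSeries_sum hF, Finset.sum_mul, map_sum]

lemma leftAction_add {i : Fin J.M} {j : Fin (J.s i)} {k : ℕ} {f g : ℂ → ℂ}
    (hf : AnalyticAt ℂ f (J.x i)) (hg : AnalyticAt ℂ g (J.x i)) (a : Fin p) :
    leftAction J i j k (fun t => f t + g t) a =
      leftAction J i j k f a + leftAction J i j k g a := by
  simp only [leftAction, taylorSeries_add hf hg, add_mul, map_add]

lemma leftAction_sub {i : Fin J.M} {j : Fin (J.s i)} {k : ℕ} {f g : ℂ → ℂ}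
    (hf : AnalyticAt ℂ f (J.x i)) (hg : AnalyticAt ℂ g (J.x i)) (a : Fin p) :
    leftAction J i j k (fun t => f t - g t) a =
      leftAction J i j k f a - leftAction J i j k g a := by
  simp only [leftAction, taylorSeries_sub hf hg, sub_mul, map_sub]

lemma leftAction_const_mul {i : Fin J.M} {j : Fin (J.s i)} {k : ℕ} (c : ℂ) {g : ℂ → ℂ}
    (a : Fin p) :
    leftAction J i j k (fun t => c * g t) a = c * leftAction J i j k g a := by
  simp only [leftAction, taylorSeries_const_mul c, smul_mul_assoc, PowerSeries.coeff_smul,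
    smul_eq_mul]

/-- This makes the masses invisible on multiples `R Q`, and removes the `R(t)` part of the divided
difference. -/
lemma leftAction_mul_eq_zero {i : Fin J.M} {j : Fin (J.s i)} {k : ℕ} (hk : k < J.κ i j)
    {g : ℂ → ℂ} (hg : AnalyticAt ℂ g (J.x i)) (a' : Fin p) :
    ∑ a, leftAction J i j k (fun t => g t * (R a a').eval t) a = 0 := by
  simp only [leftAction, taylorSeries_mul hg (analyticAt_eval _ _), taylorSeries_eval, mul_assoc,
    ← map_sum, ← Finset.mul_sum]
  exact coeff_mul_eq_zero (fun k hk => (J.left i).coeff_eq_zero j a' k hk) hk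

/-- As a function of `z` this is a finite combination of negative powers of `z - x_i`, hence its
only possible pole is `x_i`. -/
lemma analyticAt_leftAction_div {i : Fin J.M} {j : Fin (J.s i)} {k : ℕ} {g : ℂ → ℂ}
    (hg : AnalyticAt ℂ g (J.x i)) {x : ℂ} (hx : x ≠ J.x i) (a : Fin p) :
    AnalyticAt ℂ (fun z => leftAction J i j k (fun t => g t / (z - t)) a) x := by
  have h : (fun z => leftAction J i j k (fun t => g t / (z - t)) a) =ᶠ[𝓝 x] fun z =>
      ∑ l ∈ Finset.range (k + 1), (∑ m ∈ Finset.HasAntidiagonal.antidiagonal l,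
        PowerSeries.coeff m.1 (taylorSeries g (J.x i)) * ((z - J.x i) ^ (m.2 + 1))⁻¹) *
        J.vL i j (k - l) a := by
    filter_upwards [eventually_ne_nhds hx] with z hz
    have h1 : AnalyticAt ℂ (fun t => (z - t)⁻¹) (J.x i) :=
      AnalyticAt.fun_inv (by fun_prop) (sub_ne_zero.2 hz)
    simp only [leftAction, div_eq_mul_inv, taylorSeries_mul hg h1, taylorSeries_inv_sub hz,
      coeff_mul_chainSeries]
    simp only [PowerSeries.coeff_mul, PowerSeries.coeff_mk]
  refine AnalyticAt.congr ?_ h.symm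
  have h2 : x - J.x i ≠ 0 := sub_ne_zero.2 hx
  refine Finset.analyticAt_fun_sum _ fun l _ => AnalyticAt.fun_mul ?_ analyticAt_const
  refine Finset.analyticAt_fun_sum _ fun m _ => AnalyticAt.fun_mul analyticAt_const ?_
  exact AnalyticAt.fun_inv (by fun_prop) (pow_ne_zero _ h2)

end Chains

open MeasureTheory

/-! ### Integrability and Cauchy transforms off the support -/

section Cauchy

lemma integrable_eval {μ : Measure ℝ} (hmom : ∀ k : ℕ, Integrable (fun t : ℝ => t ^ k) μ)
    (f : ℂ[X]) : Integrable (fun t : ℝ => f.eval (t : ℂ)) μ := by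
  simp only [eval_eq_sum_range]
  refine integrable_finsetSum _ fun k _ => Integrable.const_mul ?_ _
  simpa using (hmom k).ofReal (𝕜 := ℂ)

lemma ae_mem_of_measure_compl_eq_zero {μ : Measure ℝ} {Δ : Set ℝ} (hμ : μ Δᶜ = 0) :
    ∀ᵐ t ∂μ, t ∈ Δ := hμ

/-- A polynomial without zeros on a closed set of real numbers is bounded away from `0` on it. -/
lemma exists_le_norm_eval {P : ℂ[X]} {Δ : Set ℝ} (hΔ : IsClosed Δ)
    (hP : ∀ t ∈ Δ, ¬ P.IsRoot (t : ℂ)) : ∃ c > 0, ∀ t ∈ Δ, c ≤ ‖P.eval (t : ℂ)‖ := by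
  rcases Δ.eq_empty_or_nonempty with rfl | ⟨t₀, ht₀⟩
  · exact ⟨1, one_pos, fun t ht => ht.elim⟩
  rcases lt_or_ge 0 P.degree with h | h
  · have h1 : Filter.Tendsto (fun t : ℝ => ‖P.eval (t : ℂ)‖) (Filter.cocompact ℝ) Filter.atTop := by
      refine P.tendsto_norm_atTop h ?_
      simpa only [Complex.norm_real] using tendsto_norm_cocompact_atTop (E := ℝ)
    have hc : Continuous fun t : ℝ => ‖P.eval (t : ℂ)‖ := by fun_prop
    obtain ⟨t₁, ht₁, h2⟩ := hc.continuousOn.exists_isMinOn' hΔ ht₀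
      ((h1.eventually_ge_atTop _).filter_mono inf_le_left)
    exact ⟨_, norm_pos_iff.2 (hP t₁ ht₁), fun t ht => h2 ht⟩
  · rw [eq_C_of_degree_le_zero h] at hP ⊢
    refine ⟨_, norm_pos_iff.2 (hP t₀ ht₀), fun t _ => ?_⟩
    simp

lemma exists_le_norm_sub {Δ : Set ℝ} (hΔ : IsClosed Δ) {x : ℂ} (hx : ∀ t ∈ Δ, (t : ℂ) ≠ x) :
    ∃ δ > 0, ∀ z ∈ Metric.ball x δ, ∀ t ∈ Δ, δ ≤ ‖z - (t : ℂ)‖ := by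
  have h1 : IsClosed ((fun t : ℝ => (t : ℂ)) '' Δ) :=
    Complex.isometry_ofReal.isClosedEmbedding.isClosedMap _ hΔ
  have h2 : ((fun t : ℝ => (t : ℂ)) '' Δ)ᶜ ∈ 𝓝 x := h1.isOpen_compl.mem_nhds (by
    rintro ⟨t, ht, h⟩; exact hx t ht h)
  obtain ⟨ε, hε, h3⟩ := Metric.mem_nhds_iff.1 h2
  refine ⟨ε / 2, half_pos hε, fun z hz t ht => ?_⟩
  by_contra hlt
  suffices hmem : (t : ℂ) ∈ Metric.ball x ε from h3 hmem ⟨t, ht, rfl⟩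
  rw [Metric.mem_ball] at hz ⊢
  rw [not_le, ← dist_eq_norm, dist_comm] at hlt
  linarith [dist_triangle (t : ℂ) z x]

lemma integrable_div_sub {μ : Measure ℝ} {Δ : Set ℝ} (hμ : μ Δᶜ = 0) {g : ℝ → ℂ}
    (hg : Integrable g μ) {δ : ℝ} (hδ : 0 < δ) {z : ℂ} (hz : ∀ t ∈ Δ, δ ≤ ‖z - (t : ℂ)‖) :
    Integrable (fun t : ℝ => g t / (z - t)) μ := by
  refine (hg.norm.div_const δ).mono' ?_ ?_
  · exact hg.aestronglyMeasurable.div₀ (by fun_prop)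
  · filter_upwards [ae_mem_of_measure_compl_eq_zero hμ] with t ht
    rw [norm_div]
    exact div_le_div_of_nonneg_left (norm_nonneg _) hδ (hz t ht)

/-- The Cauchy transform of an integrable density is analytic off the closed set carrying the
measure. -/
lemma analyticAt_integral_div_sub {μ : Measure ℝ} {Δ : Set ℝ} (hΔ : IsClosed Δ) (hμ : μ Δᶜ = 0)
    {g : ℝ → ℂ} (hg : Integrable g μ) {x : ℂ} (hx : ∀ t ∈ Δ, (t : ℂ) ≠ x) :
    AnalyticAt ℂ (fun z => ∫ t, g t / (z - t) ∂μ) x := by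
  obtain ⟨δ, hδ, h⟩ := exists_le_norm_sub hΔ hx
  refine DifferentiableOn.analyticAt (s := Metric.ball x δ) (fun z hz => ?_)
    (Metric.ball_mem_nhds x hδ)
  have h1 : ∀ y ∈ Metric.ball x δ, Integrable (fun t : ℝ => g t / (y - t)) μ :=
    fun y hy => integrable_div_sub hμ hg hδ (h y hy)
  have hnhds := Metric.isOpen_ball.mem_nhds hz
  refine (hasDerivAt_integral_of_dominated_loc_of_deriv_le (F := fun z t => g t / (z - t))
    (F' := fun z t => -g t / (z - t) ^ 2) (bound := fun t => ‖g t‖ / δ ^ 2) hnhds ?_ (h1 z hz)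
    ?_ ?_ (hg.norm.div_const _) ?_).2.differentiableAt.differentiableWithinAt
  · filter_upwards [hnhds] with y hy using (h1 y hy).aestronglyMeasurable
  · exact hg.neg.aestronglyMeasurable.div₀ (by fun_prop)
  · filter_upwards [ae_mem_of_measure_compl_eq_zero hμ] with t ht y hy
    rw [norm_div, norm_neg, norm_pow]
    exact div_le_div_of_nonneg_left (norm_nonneg _) (by positivity)
      (pow_le_pow_left₀ hδ.le (h y hy t ht) 2)
  · filter_upwards [ae_mem_of_measure_compl_eq_zero hμ] with t ht y hy
    have h2 : y - (t : ℂ) ≠ 0 := norm_pos_iff.1 (hδ.trans_le (h y hy t ht))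
    have h3 : HasDerivAt (fun y : ℂ => y - (t : ℂ)) 1 y := (hasDerivAt_id y).sub_const _
    have h4 := (hasDerivAt_const y (g t)).fun_div h3 h2
    simpa using h4

end Cauchy

/-! ### The inverse matrix on the support -/

section Inverse

variable {p : ℕ} {R : Matrix (Fin p) (Fin p) ℂ[X]}

lemma derivAt_zero_apply (z : ℂ) (a a' : Fin p) : derivAt R 0 z a a' = (R a a').eval z := rfl

lemma det_derivAt_zero (z : ℂ) : (derivAt R 0 z).det = R.det.eval z :=
  ((evalRingHom z).map_det R).symm

lemma inv_derivAt_zero_apply (z : ℂ) (a a' : Fin p) :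
    (derivAt R 0 z)⁻¹ a a' = (R.adjugate a a').eval z * (R.det.eval z)⁻¹ := by
  have h : (derivAt R 0 z).adjugate = R.adjugate.map (fun f => f.eval z) :=
    ((evalRingHom z).map_adjugate R).symm
  rw [Matrix.inv_def, Ring.inverse_eq_inv', det_derivAt_zero, Matrix.smul_apply, h, smul_eq_mul,
    mul_comm]
  rfl

lemma sum_inv_mul {z : ℂ} (hz : ¬ R.det.IsRoot z) (a' a'' : Fin p) :
    ∑ a, (derivAt R 0 z)⁻¹ a' a * (R a a'').eval z = if a' = a'' then 1 else 0 := by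
  have h : (derivAt R 0 z)⁻¹ * derivAt R 0 z = 1 :=
    Matrix.nonsing_inv_mul _ (by rw [det_derivAt_zero]; exact isUnit_iff_ne_zero.2 hz)
  rw [← Matrix.one_apply, ← h, Matrix.mul_apply]
  rfl

/-- The entries of the inverse are adjugate entries over `det R`, and `det R` is bounded away from
`0` on the closed carrying set, so a polynomial dominates the integrand. -/
lemma integrable_eval_mul_inv {μ : Measure ℝ}
    (hmom : ∀ k : ℕ, Integrable (fun t : ℝ => t ^ k) μ) {Δ : Set ℝ} (hΔ : IsClosed Δ)
    (hμ : μ Δᶜ = 0) (hσ : ∀ t ∈ Δ, ¬ R.det.IsRoot (t : ℂ)) (f : ℂ[X]) (a a' : Fin p) :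
    Integrable (fun t : ℝ => f.eval (t : ℂ) * (derivAt R 0 (t : ℂ))⁻¹ a a') μ := by
  obtain ⟨c, hc, h⟩ := exists_le_norm_eval hΔ hσ
  have heq : (fun t : ℝ => f.eval (t : ℂ) * (derivAt R 0 (t : ℂ))⁻¹ a a') =
      fun t : ℝ => (f * R.adjugate a a').eval (t : ℂ) / R.det.eval (t : ℂ) := by
    ext t
    rw [inv_derivAt_zero_apply, eval_mul, div_eq_mul_inv, mul_assoc]
  generalize R.adjugate a a' = g at heq
  generalize R.det = D at heq h
  rw [heq]
  refine ((integrable_eval hmom (f * g)).norm.div_const c).mono' ?_ ?_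
  · exact (integrable_eval hmom _).aestronglyMeasurable.div₀
      (Continuous.aestronglyMeasurable (by fun_prop))
  · filter_upwards [ae_mem_of_measure_compl_eq_zero hμ] with t ht
    rw [norm_div]
    exact div_le_div_of_nonneg_left (norm_nonneg _) hc (h t ht)

end Inverse

/-! ### Divided differences -/

section DivDiff

/-- The divided difference `(f(z) - f(t)) / (z - t)` as a polynomial in `t`, for
`natDegree f ≤ N`. -/
def divDiff (N : ℕ) (f : ℂ[X]) (z : ℂ) : ℂ[X] :=
  ∑ c ∈ Finset.range N, C ((divX^[c + 1] f).eval z) * X ^ c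

lemma coeff_iterate_divX (f : ℂ[X]) (c m : ℕ) : (divX^[c] f).coeff m = f.coeff (m + c) := by
  induction c generalizing m with
  | zero => rfl
  | succ c ih => rw [Function.iterate_succ_apply', coeff_divX, ih, add_right_comm, add_assoc]

lemma eval_iterate_divX (f : ℂ[X]) (c : ℕ) (z : ℂ) :
    (divX^[c] f).eval z = z * (divX^[c + 1] f).eval z + f.coeff c := by
  conv_lhs => rw [← X_mul_divX_add (divX^[c] f)]
  rw [Function.iterate_succ_apply', eval_add, eval_mul, eval_X, eval_C, coeff_iterate_divX,
    zero_add]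

lemma sub_mul_eval_divDiff {N : ℕ} {f : ℂ[X]} (hf : f.natDegree ≤ N) (z t : ℂ) :
    (z - t) * (divDiff N f z).eval t = f.eval z - f.eval t := by
  have h : ∀ n, (z - t) * (divDiff n f z).eval t =
      f.eval z - (∑ c ∈ Finset.range n, f.coeff c * t ^ c) - (divX^[n] f).eval z * t ^ n := by
    intro n
    induction n with
    | zero => simp [divDiff]
    | succ n ih =>
      have h1 : (divDiff (n + 1) f z).eval t =
          (divDiff n f z).eval t + (divX^[n + 1] f).eval z * t ^ n := by
        simp [divDiff, Finset.sum_range_succ]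
      rw [h1, mul_add, ih, Finset.sum_range_succ, eval_iterate_divX f n]
      ring
  have h2 : divX^[N] f = C (f.coeff N) := by
    ext m
    rw [coeff_iterate_divX, coeff_C]
    split_ifs with hm
    · rw [hm, zero_add]
    · exact coeff_eq_zero_of_natDegree_lt (by omega)
  rw [h, h2, eval_C, eval_eq_sum_range' (Nat.lt_succ_of_le hf) t, Finset.sum_range_succ]
  ring

end DivDiff

/-! ### The absolutely continuous part `dμ R⁻¹` -/

section Density

variable {q p : ℕ} {R : Matrix (Fin p) (Fin p) ℂ[X]}

/-- The part `dμ R⁻¹` of the perturbed matrix of measures. -/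
def densityPart (μ : Fin q → Fin p → Measure ℝ) (R : Matrix (Fin p) (Fin p) ℂ[X]) :
    MatFunctional q p :=
  fun b a f => ∑ a', ∫ t, f.eval (t : ℂ) * ((derivAt R 0 (t : ℂ))⁻¹ a' a) ∂(μ b a')

/-- The Cauchy transform of `P dμ R⁻¹`. -/
def densityTransform (μ : Fin q → Fin p → Measure ℝ) (R : Matrix (Fin p) (Fin p) ℂ[X])
    (P : Fin q → ℂ[X]) (z : ℂ) (a : Fin p) : ℂ :=
  ∑ b, ∑ a', ∫ t : ℝ, (P b).eval (t : ℂ) * (derivAt R 0 (t : ℂ))⁻¹ a' a / (z - t) ∂(μ b a')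

variable {μ : Fin q → Fin p → Measure ℝ} {Δ : Fin q → Fin p → Set ℝ}

lemma isLinearMap_ofMeasure (hmom : ∀ b a, ∀ k : ℕ, Integrable (fun t : ℝ => t ^ k) (μ b a))
    (b : Fin q) (a : Fin p) : IsLinearMap ℂ (ofMeasure μ b a) where
  map_add f g := by
    simp only [ofMeasure, eval_add]
    exact integral_add (integrable_eval (hmom b a) f) (integrable_eval (hmom b a) g)
  map_smul c f := by
    simp only [ofMeasure, eval_smul, smul_eq_mul]
    exact integral_const_mul c _

lemma isLinearMap_densityPart
    (hmom : ∀ b a, ∀ k : ℕ, Integrable (fun t : ℝ => t ^ k) (μ b a))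
    (hΔ : ∀ b a, IsClosed (Δ b a)) (hμΔ : ∀ b a, μ b a (Δ b a)ᶜ = 0)
    (hσ : ∀ b a, ∀ t ∈ Δ b a, ¬ R.det.IsRoot (t : ℂ)) (b : Fin q) (a : Fin p) :
    IsLinearMap ℂ (densityPart μ R b a) where
  map_add f g := by
    simp only [densityPart, eval_add, add_mul, ← Finset.sum_add_distrib]
    exact Finset.sum_congr rfl fun a' _ => integral_add
      (integrable_eval_mul_inv (hmom b a') (hΔ b a') (hμΔ b a') (hσ b a') f a' a)
      (integrable_eval_mul_inv (hmom b a') (hΔ b a') (hμΔ b a') (hσ b a') g a' a)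
  map_smul c f := by
    simp only [densityPart, eval_smul, smul_eq_mul, mul_assoc, Finset.mul_sum]
    exact Finset.sum_congr rfl fun a' _ => integral_const_mul c _

lemma sum_densityPart_mul
    (hmom : ∀ b a, ∀ k : ℕ, Integrable (fun t : ℝ => t ^ k) (μ b a))
    (hΔ : ∀ b a, IsClosed (Δ b a)) (hμΔ : ∀ b a, μ b a (Δ b a)ᶜ = 0)
    (hσ : ∀ b a, ∀ t ∈ Δ b a, ¬ R.det.IsRoot (t : ℂ)) (b : Fin q) (P : ℂ[X])
    (Q : Fin p → ℂ[X]) :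
    ∑ a, densityPart μ R b a (P * (R *ᵥ Q) a) = ∑ a, ofMeasure μ b a (P * Q a) := by
  simp only [densityPart, ofMeasure]
  rw [Finset.sum_comm]
  refine Finset.sum_congr rfl fun a' _ => ?_
  rw [← integral_finsetSum _ fun a _ => integrable_eval_mul_inv (hmom b a') (hΔ b a') (hμΔ b a')
    (hσ b a') _ a' a]
  refine integral_congr_ae ?_
  filter_upwards [ae_mem_of_measure_compl_eq_zero (hμΔ b a')] with t ht
  have h := fun a'' => sum_inv_mul (hσ b a' t ht) a' a''
  simp only [eval_mul, Matrix.mulVec, dotProduct, eval_finsetSum]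
  calc _ = P.eval (t : ℂ) * ∑ a'', (∑ a, (derivAt R 0 (t : ℂ))⁻¹ a' a * (R a a'').eval (t : ℂ)) *
        (Q a'').eval (t : ℂ) := by
        simp only [Finset.mul_sum, Finset.sum_mul]
        rw [Finset.sum_comm]
        exact Finset.sum_congr rfl fun _ _ => Finset.sum_congr rfl fun _ _ => by ring
    _ = _ := by simp [h]

lemma analyticAt_cauchyD
    (hmom : ∀ b a, ∀ k : ℕ, Integrable (fun t : ℝ => t ^ k) (μ b a))
    (hΔ : ∀ b a, IsClosed (Δ b a)) (hμΔ : ∀ b a, μ b a (Δ b a)ᶜ = 0) {x : ℂ}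
    (hx : ∀ b a, ∀ t ∈ Δ b a, (t : ℂ) ≠ x) (B : ℕ → Fin q → ℂ[X]) (n : ℕ) (a : Fin p) :
    AnalyticAt ℂ (fun z => cauchyD μ B n z a) x :=
  Finset.analyticAt_fun_sum _ fun b _ => analyticAt_integral_div_sub (hΔ b a) (hμΔ b a)
    (integrable_eval (hmom b a) (B n b)) (hx b a)

lemma analyticAt_densityTransform
    (hmom : ∀ b a, ∀ k : ℕ, Integrable (fun t : ℝ => t ^ k) (μ b a))
    (hΔ : ∀ b a, IsClosed (Δ b a)) (hμΔ : ∀ b a, μ b a (Δ b a)ᶜ = 0)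
    (hσ : ∀ b a, ∀ t ∈ Δ b a, ¬ R.det.IsRoot (t : ℂ)) {x : ℂ}
    (hx : ∀ b a, ∀ t ∈ Δ b a, (t : ℂ) ≠ x) (P : Fin q → ℂ[X]) (a : Fin p) :
    AnalyticAt ℂ (fun z => densityTransform μ R P z a) x :=
  Finset.analyticAt_fun_sum _ fun b _ => Finset.analyticAt_fun_sum _ fun a' _ =>
    analyticAt_integral_div_sub (hΔ b a') (hμΔ b a')
      (integrable_eval_mul_inv (hmom b a') (hΔ b a') (hμΔ b a') (hσ b a') (P b) a' a) (hx b a')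

/-- The part `dμ R⁻¹` applied to the divided difference of `R`. -/
lemma sum_densityPart_divDiff
    (hmom : ∀ b a, ∀ k : ℕ, Integrable (fun t : ℝ => t ^ k) (μ b a))
    (hΔ : ∀ b a, IsClosed (Δ b a)) (hμΔ : ∀ b a, μ b a (Δ b a)ᶜ = 0)
    (hσ : ∀ b a, ∀ t ∈ Δ b a, ¬ R.det.IsRoot (t : ℂ)) {N : ℕ}
    (hN : ∀ a a', (R a a').natDegree ≤ N) {x : ℂ}
    (hx : ∀ b a, ∀ t ∈ Δ b a, (t : ℂ) ≠ x) (B : ℕ → Fin q → ℂ[X]) (n : ℕ) :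
    ∀ᶠ z in 𝓝 x, ∀ a'', ∑ b, ∑ a, densityPart μ R b a (B n b * divDiff N (R a a'') z) =
      ∑ a, densityTransform μ R (B n) z a * (R a a'').eval z - cauchyD μ B n z a'' := by
  choose δ hδ hball using fun b a => exists_le_norm_sub (hΔ b a) (hx b a)
  have hev : ∀ᶠ z in 𝓝 x, ∀ b a, z ∈ Metric.ball x (δ b a) :=
    Filter.eventually_all.2 fun b => Filter.eventually_all.2 fun a =>
      Metric.ball_mem_nhds x (hδ b a)
  filter_upwards [hev] with z hz a''
  have hint : ∀ b a a', Integrable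
      (fun t : ℝ => (B n b).eval (t : ℂ) * (derivAt R 0 (t : ℂ))⁻¹ a' a / (z - t)) (μ b a') :=
    fun b a a' => integrable_div_sub (hμΔ b a')
      (integrable_eval_mul_inv (hmom b a') (hΔ b a') (hμΔ b a') (hσ b a') (B n b) a' a)
      (hδ b a') (hball b a' z (hz b a'))
  have hint' : ∀ b a, Integrable (fun t : ℝ => (B n b).eval (t : ℂ) / (z - t)) (μ b a) :=
    fun b a => integrable_div_sub (hμΔ b a) (integrable_eval (hmom b a) (B n b))
      (hδ b a) (hball b a z (hz b a))
  -- Pointwise, the `R(z)` part of the divided difference leaves a Cauchy transform times `R(z)`,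
  -- while in the `R(t)` part the product `R⁻¹(t) R(t) = 1` leaves the Cauchy transform of `μ`
  -- itself.
  have key : ∀ b a', ∑ a, ∫ t : ℝ, (B n b * divDiff N (R a a'') z).eval (t : ℂ) *
        (derivAt R 0 (t : ℂ))⁻¹ a' a ∂(μ b a') =
      ∑ a, (∫ t : ℝ, (B n b).eval (t : ℂ) * (derivAt R 0 (t : ℂ))⁻¹ a' a / (z - t) ∂(μ b a')) *
        (R a a'').eval z - if a' = a'' then ∫ t : ℝ, (B n b).eval (t : ℂ) / (z - t) ∂(μ b a')
          else 0 := by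
    intro b a'
    have h1 : (if a' = a'' then ∫ t : ℝ, (B n b).eval (t : ℂ) / (z - t) ∂(μ b a') else 0) =
        ∫ t : ℝ, (B n b).eval (t : ℂ) / (z - t) * (if a' = a'' then 1 else 0) ∂(μ b a') := by
      split_ifs <;> simp
    simp only [← integral_mul_const]
    rw [h1, ← integral_finsetSum _ fun a _ => integrable_eval_mul_inv (hmom b a') (hΔ b a')
      (hμΔ b a') (hσ b a') _ a' a, ← integral_finsetSum _ fun a _ => (hint b a a').mul_const _,
      ← integral_sub (integrable_finsetSum _ fun a _ => (hint b a a').mul_const _)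
        ((hint' b a').mul_const _)]
    refine integral_congr_ae ?_
    filter_upwards [ae_mem_of_measure_compl_eq_zero (hμΔ b a')] with t ht
    have h2 : z - (t : ℂ) ≠ 0 :=
      norm_pos_iff.1 ((hδ b a').trans_le (hball b a' z (hz b a') t ht))
    have h3 : ∀ a, (divDiff N (R a a'') z).eval (t : ℂ) =
        ((R a a'').eval z - (R a a'').eval (t : ℂ)) / (z - t) := fun a => by
      rw [← sub_mul_eval_divDiff (hN a a''), mul_div_cancel_left₀ _ h2]
    rw [← sum_inv_mul (hσ b a' t ht) a' a'', Finset.mul_sum, ← Finset.sum_sub_distrib]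
    refine Finset.sum_congr rfl fun a _ => ?_
    rw [eval_mul, h3]
    field_simp
  simp only [densityPart, densityTransform, cauchyD]
  have h4 : ∀ b, ∑ a, ∑ a', ∫ t : ℝ, (B n b * divDiff N (R a a'') z).eval (t : ℂ) *
        (derivAt R 0 (t : ℂ))⁻¹ a' a ∂(μ b a') =
      ∑ a, ∑ a', (∫ t : ℝ, (B n b).eval (t : ℂ) * (derivAt R 0 (t : ℂ))⁻¹ a' a / (z - t) ∂(μ b a')) *
        (R a a'').eval z - ∫ t : ℝ, (B n b).eval (t : ℂ) / (z - t) ∂(μ b a'') := by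
    intro b
    rw [Finset.sum_comm, Finset.sum_congr rfl fun a' _ => key b a', Finset.sum_sub_distrib,
      Finset.sum_comm]
    simp
  rw [Finset.sum_congr rfl fun b _ => h4 b, Finset.sum_sub_distrib, Finset.sum_comm]
  simp only [Finset.sum_mul]

end Density

/-! ### Degree of `det R` and the number of chain conditions -/

section Degree

lemma natDegree_prod_le_and_coeff {ι : Type*} (s : Finset ι) (f : ι → ℂ[X]) (n : ι → ℕ)
    (h : ∀ i ∈ s, (f i).natDegree ≤ n i) :
    (∏ i ∈ s, f i).natDegree ≤ ∑ i ∈ s, n i ∧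
      (∏ i ∈ s, f i).coeff (∑ i ∈ s, n i) = ∏ i ∈ s, (f i).coeff (n i) := by
  classical
  induction s using Finset.induction_on with
  | empty => simp
  | insert i s hi ih =>
    have h1 := ih fun j hj => h j (Finset.mem_insert_of_mem hj)
    have h2 := h i (Finset.mem_insert_self i s)
    rw [Finset.prod_insert hi, Finset.sum_insert hi, Finset.prod_insert hi]
    exact ⟨natDegree_mul_le_of_le h2 h1.1, by
      rw [coeff_mul_add_eq_of_natDegree_le h2 h1.1, h1.2]⟩

/-- The determinant of the leading column coefficients. -/
lemma coeff_det_of_natDegree_le {p : ℕ} (R : Matrix (Fin p) (Fin p) ℂ[X]) (n : Fin p → ℕ)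
    (h : ∀ a a', (R a a').natDegree ≤ n a') :
    R.det.natDegree ≤ ∑ a, n a ∧
      R.det.coeff (∑ a, n a) = (Matrix.of fun a a' => (R a a').coeff (n a')).det := by
  have h1 := fun σ : Equiv.Perm (Fin p) =>
    natDegree_prod_le_and_coeff Finset.univ (fun i => R (σ i) i) n fun i _ => h _ i
  constructor
  · rw [Matrix.det_apply]
    refine natDegree_sum_le_of_forall_le _ _ fun σ _ => ?_
    exact (natDegree_smul_le _ _).trans (h1 σ).1
  · rw [Matrix.det_apply, Matrix.det_apply, finsetSum_coeff]
    refine Finset.sum_congr rfl fun σ _ => ?_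
    rw [coeff_smul, (h1 σ).2]
    rfl

variable {p : ℕ} {R : Matrix (Fin p) (Fin p) ℂ[X]} {N r : ℕ}

/-- The first `r` columns have degree at most `N - 1`, the others at most `N`. The matrix of these
column-leading coefficients has block form `[*, I; I, 0]`, so it is nonsingular and the degree bound
for the determinant is attained. -/
lemma HasLeadingForm.natDegree_det (hR : HasLeadingForm R N r) (hN : 1 ≤ N) (hr : r < p) :
    R.det ≠ 0 ∧ R.det.natDegree = N * p - r := by
  let n : Fin p → ℕ := fun a' => if (a' : ℕ) < r then N - 1 else N
  have hn : ∀ a a', (R a a').natDegree ≤ n a' := by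
    intro a a'
    simp only [n]
    split_ifs with h
    · refine natDegree_le_pred (hR.natDegree_le a a') ?_
      rw [hR.leading, if_neg (by omega)]
    · exact hR.natDegree_le a a'
  have hsum : ∑ a, n a = N * p - r := by
    have h1 : ∑ a, n a + ∑ a : Fin p, (if (a : ℕ) < r then 1 else 0) = N * p := by
      rw [← Finset.sum_add_distrib, Finset.sum_congr rfl fun a _ => show
        n a + (if (a : ℕ) < r then 1 else 0) = N by simp only [n]; split_ifs <;> omega]
      simp [mul_comm]
    have h2 : ∑ a : Fin p, (if (a : ℕ) < r then 1 else 0) = r := by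
      rw [Fin.sum_univ_eq_sum_range (fun k => if k < r then 1 else 0) p, ← Finset.sum_filter,
        show (Finset.range p).filter (· < r) = Finset.range r by ext; simp; omega]
      simp
    omega
  have hdet : (Matrix.of fun a a' => (R a a').coeff (n a')).det ≠ 0 := by
    intro h0
    obtain ⟨v, hv0, hv⟩ := Matrix.exists_mulVec_eq_zero_iff.2 h0
    have hv' : ∀ a, ∑ a', (R a a').coeff (n a') * v a' = 0 := fun a => congrFun hv a
    have h1 : ∀ b : Fin p, (b : ℕ) < r → v b = 0 := by
      intro b hb
      have h2 := hv' ⟨b + (p - r), by omega⟩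
      rw [Finset.sum_eq_single b] at h2
      · simp only [n, if_pos hb] at h2
        rwa [hR.subleading _ _ (by simp) hb, if_pos rfl, one_mul] at h2
      · intro b' _ hne
        simp only [n]
        split_ifs with h
        · rw [hR.subleading _ _ (by simp) h, if_neg, zero_mul]
          intro h3
          exact hne (Fin.ext (by simp only at h3; omega))
        · rw [hR.leading, if_neg (by simp only; omega), zero_mul]
      · simp
    refine hv0 (funext fun b => ?_)
    by_cases hb : (b : ℕ) < r
    · exact h1 b hb
    · have h2 := hv' ⟨b - r, by omega⟩
      rw [Finset.sum_eq_single b] at h2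
      · simp only [n, if_neg hb] at h2
        rwa [hR.leading, if_pos (by simp only; omega), one_mul] at h2
      · intro b' _ hne
        by_cases h : (b' : ℕ) < r
        · rw [h1 b' h, mul_zero]
        · simp only [n, if_neg h]
          rw [hR.leading, if_neg, zero_mul]
          intro h3
          exact hne (Fin.ext (by simp only at h3; omega))
      · simp
  have h := coeff_det_of_natDegree_le R n hn
  rw [← h.2, hsum] at hdet
  rw [hsum] at h
  exact ⟨fun h0 => hdet (by rw [h0, coeff_zero]),
    le_antisymm h.1 (le_natDegree_of_ne_zero hdet)⟩

lemma JordanData.size_eq (J : JordanData R) (h0 : R.det ≠ 0) : J.size = R.det.natDegree := by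
  classical
  have h1 : ∀ i, ∑ j, J.κ i j = R.det.roots.count (J.x i) := fun i => by
    rw [(J.right i).sum_eq, count_roots]
  have h2 : R.det.roots.toFinset = Finset.univ.image J.x := by
    ext z
    rw [Multiset.mem_toFinset, mem_roots h0, J.isRoot_iff]
    simp
  rw [JordanData.size, ← (splits_iff_card_roots.1 (IsAlgClosed.splits R.det)),
    ← Multiset.toFinset_sum_count_eq, h2, Finset.sum_image fun _ _ _ _ h => J.x_injective h]
  exact Finset.sum_congr rfl fun i _ => h1 i

end Degree

/-! ### Hermite interpolation along right Jordan chains -/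

section ChainEval

variable {p : ℕ} {R : Matrix (Fin p) (Fin p) ℂ[X]} (J : JordanData R)

/-- The action of the right chains on row vector polynomials. -/
def chainEval (i : Fin J.M) (j : Fin (J.s i)) (k : ℕ) : (Fin p → ℂ[X]) →ₗ[ℂ] ℂ where
  toFun P := PowerSeries.coeff k
    (∑ a, ((taylor (J.x i) (P a) : ℂ[X]) : PowerSeries ℂ) * chainSeries (J.vR i j) a)
  map_add' P Q := by
    simp only [Pi.add_apply, map_add, Polynomial.coe_add, add_mul, Finset.sum_add_distrib]
  map_smul' c P := by
    simp only [Pi.smul_apply, map_smul, Polynomial.coe_smul, smul_mul_assoc, ← Finset.smul_sum,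
      smul_eq_mul, RingHom.id_apply]

lemma chainEval_apply (i : Fin J.M) (j : Fin (J.s i)) (k : ℕ) (P : Fin p → ℂ[X]) :
    chainEval J i j k P = PowerSeries.coeff k
      (∑ a, ((taylor (J.x i) (P a) : ℂ[X]) : PowerSeries ℂ) * chainSeries (J.vR i j) a) := rfl

lemma chainAction_eval (i : Fin J.M) (j : Fin (J.s i)) (k : ℕ) (P : Fin p → ℂ[X]) :
    chainAction J i j k (fun y a => (P a).eval y) (J.x i) = chainEval J i j k P := by
  simp only [chainAction_eq, chainEval_apply, taylorSeries_eval]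

lemma chainEval_mul_row {i : Fin J.M} {j : Fin (J.s i)} {k : ℕ} (hk : k < J.κ i j) (Q : ℂ[X])
    (a : Fin p) : chainEval J i j k (fun a' => Q * R a a') = 0 := by
  simp only [chainEval_apply, taylor_mul, Polynomial.coe_mul, mul_assoc, ← Finset.mul_sum]
  exact coeff_mul_eq_zero (fun k hk => (J.right i).coeff_eq_zero j a k hk) hk

lemma chainEval_pow_mul (i : Fin J.M) (j : Fin (J.s i)) (k n : ℕ) (P : Fin p → ℂ[X]) :
    chainEval J i j k (fun a => (X - C (J.x i)) ^ n * P a) =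
      if n ≤ k then chainEval J i j (k - n) P else 0 := by
  simp only [chainEval_apply, taylor_mul, taylor_pow, Polynomial.coe_mul, mul_assoc,
    ← Finset.mul_sum]
  have h : taylor (J.x i) (X - C (J.x i)) = X := by simp
  rw [h, Polynomial.coe_pow, Polynomial.coe_X, PowerSeries.coeff_X_pow_mul']

lemma exists_linearMap_apply_eq {ι V : Type*} [AddCommGroup V] [Module ℂ V] {v : ι → V}
    (hv : LinearIndependent ℂ v) (c : ι → ℂ) : ∃ f : V →ₗ[ℂ] ℂ, ∀ j, f (v j) = c j := by
  obtain ⟨g, hg⟩ := (Finsupp.linearCombination ℂ v).exists_leftInverse_of_injective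
    (LinearMap.ker_eq_bot.2 hv)
  refine ⟨Finsupp.linearCombination ℂ c ∘ₗ g, fun j => ?_⟩
  have h1 : g (v j) = Finsupp.single j 1 := by
    have := LinearMap.congr_fun hg (Finsupp.single j 1)
    simpa using this
  rw [LinearMap.comp_apply, h1, Finsupp.linearCombination_single, one_smul]

lemma exists_sum_mul_eq {s : ℕ} {v : Fin s → Fin p → ℂ} (hv : LinearIndependent ℂ v)
    (c : Fin s → ℂ) : ∃ u : Fin p → ℂ, ∀ j, ∑ a, u a * v j a = c j := by
  obtain ⟨f, hf⟩ := exists_linearMap_apply_eq hv c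
  refine ⟨fun a => f (Pi.single a 1), fun j => ?_⟩
  rw [← hf, LinearMap.pi_apply_eq_sum_univ f (v j)]
  refine Finset.sum_congr rfl fun a _ => ?_
  have h : (Pi.single a 1 : Fin p → ℂ) = fun b => if a = b then 1 else 0 :=
    funext fun b => by rw [Pi.single_apply]; exact if_congr eq_comm rfl rfl
  rw [smul_eq_mul, mul_comm]
  exact congrArg (fun w => v j a * f w) h

/-- Induction on the order: adding `(x - x_i)^n u` with constant `u` does not disturb orders below
`n` and changes order `n` by `u · v_{j;0}`, which can be prescribed for all `j` by independence.
Chain lengths play no role. -/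
lemma exists_chainEval_eq (i : Fin J.M) (c : Fin (J.s i) → ℕ → ℂ) (n : ℕ) :
    ∃ P, ∀ j, ∀ k < n, chainEval J i j k P = c j k := by
  induction n with
  | zero => exact ⟨0, fun j k hk => by omega⟩
  | succ n ih =>
    obtain ⟨P, hP⟩ := ih
    obtain ⟨u, hu⟩ := exists_sum_mul_eq (J.right i).linearIndependent
      fun j => c j n - chainEval J i j n P
    refine ⟨P + fun a => (X - C (J.x i)) ^ n * C (u a), fun j k hk => ?_⟩
    rw [map_add, chainEval_pow_mul]
    rcases Nat.lt_succ_iff_lt_or_eq.1 hk with hk | rfl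
    · rw [if_neg (by omega), add_zero, hP j k hk]
    · have h1 : chainEval J i j 0 (fun a => C (u a)) = ∑ a, u a * J.vR i j 0 a := by
        simp [chainEval_apply, chainSeries]
      rw [if_pos le_rfl, Nat.sub_self, h1, hu]
      ring

/-- Hermite interpolation along the Jordan chains. -/
lemma exists_forall_chainEval_eq (c : (i : Fin J.M) → Fin (J.s i) → ℕ → ℂ) (n : ℕ) :
    ∃ P, ∀ i j, ∀ k < n, chainEval J i j k P = c i j k := by
  choose P hP using fun i => exists_chainEval_eq J i (c i) n
  -- Different eigenvalues are glued by the Chinese remainder theorem, componentwise modulo `(x -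
  -- x_i)^n`.
  have hco : Pairwise (Function.onFun IsCoprime
      fun i => Ideal.span {(X - C (J.x i)) ^ n}) := fun i i' h => by
    rw [Function.onFun, Ideal.isCoprime_span_singleton_iff]
    exact (pairwise_coprime_X_sub_C J.x_injective h).pow
  choose Q hQ using fun a => Ideal.exists_forall_sub_mem_ideal hco fun i => P i a
  refine ⟨Q, fun i j k hk => ?_⟩
  choose g hg using fun a => Ideal.mem_span_singleton'.1 (hQ a i)
  have h : Q = P i + fun a => (X - C (J.x i)) ^ n * g a := by
    ext1 a
    rw [Pi.add_apply, mul_comm, hg]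
    ring
  rw [h, map_add, chainEval_pow_mul, if_neg (by omega), add_zero, hP i j k hk]

end ChainEval

/-! ### Tail rows of `R` and nonsingularity of their chain matrix -/

section Generation

variable {p : ℕ} {R : Matrix (Fin p) (Fin p) ℂ[X]} {N r : ℕ}

/-- The row vector polynomials `∑_{l ≥ c} (R_l)_a x^{l-c}` and the multiples of the rows of `R`
span all row vector polynomials. -/
lemma HasLeadingForm.eq_top_of_mem (hR : HasLeadingForm R N r) (hN : 1 ≤ N) (hr : r < p)
    (W : Submodule ℂ (Fin p → ℂ[X])) (h1 : ∀ c a, (fun a' => divX^[c] (R a a')) ∈ W)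
    (h2 : ∀ Q a, (fun a' => Q * R a a') ∈ W) : W = ⊤ := by
  have hconst : ∀ m, (∀ c a, (fun a' => X ^ m * divX^[c] (R a a')) ∈ W) →
      ∀ b : Fin p, (Pi.single b (X ^ m) : Fin p → ℂ[X]) ∈ W := by
    intro m hm
    -- The rows of `R_N` supply the unit vectors with index at least `r`.
    have h3 : ∀ b : Fin p, r ≤ (b : ℕ) → (Pi.single b (X ^ m) : Fin p → ℂ[X]) ∈ W := by
      intro b hb
      convert hm N ⟨b - r, by omega⟩ using 1
      ext1 a'
      have : divX^[N] (R ⟨b - r, by omega⟩ a') = if a' = b then 1 else 0 := by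
        ext l
        rw [coeff_iterate_divX]
        rcases l with _ | l
        · rw [zero_add, hR.leading]
          simp only [Fin.ext_iff, Nat.sub_add_cancel hb]
          split_ifs <;> simp
        · rw [coeff_eq_zero_of_natDegree_lt (lt_of_le_of_lt (hR.natDegree_le _ _) (by omega))]
          split_ifs <;> simp [coeff_one]
      rw [this, Pi.single_apply]
      split_ifs <;> simp
    intro b
    by_cases hb : r ≤ (b : ℕ)
    · exact h3 b hb
    · have hlt : (b : ℕ) + (p - r) < p := by omega
      have h4 := hm (N - 1) ⟨b + (p - r), hlt⟩
      have h5 : ∀ a', divX^[N - 1] (R ⟨b + (p - r), hlt⟩ a') =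
          C ((R ⟨b + (p - r), hlt⟩ a').coeff (N - 1)) := by
        intro a'
        ext l
        rw [coeff_iterate_divX, coeff_C]
        rcases l with _ | _ | l
        · simp
        · rw [show 0 + 1 + (N - 1) = N by omega, hR.leading, if_neg (by simp only; omega)]
          simp
        · rw [coeff_eq_zero_of_natDegree_lt (lt_of_le_of_lt (hR.natDegree_le _ _) (by omega))]
          simp
      -- For index below `r`, use a row of `R_{N-1}` among the last `r`: there `R_N` vanishes, so
      -- the tail is constant, and its entries from column `r` on are already disposed of.
      have h6 : (Pi.single b (X ^ m) : Fin p → ℂ[X]) =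
          (fun a' => X ^ m * divX^[N - 1] (R ⟨b + (p - r), hlt⟩ a')) -
            ∑ b' ∈ Finset.univ.filter (fun b' : Fin p => r ≤ (b' : ℕ)),
              (R ⟨b + (p - r), hlt⟩ b').coeff (N - 1) • Pi.single b' (X ^ m) := by
        ext1 a'
        rw [Pi.sub_apply, h5, Finset.sum_apply]
        simp only [Pi.smul_apply, Pi.single_apply, smul_ite, smul_zero, Finset.sum_ite_eq,
          Finset.mem_filter, Finset.mem_univ, true_and]
        by_cases ha : r ≤ (a' : ℕ)
        · rw [if_neg (by rintro rfl; omega), if_pos ha, smul_eq_C_mul]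
          ring
        · rw [if_neg ha, sub_zero, hR.subleading _ _ (by simp) (by omega)]
          by_cases hab : a' = b
          · simp [hab]
          · rw [if_neg hab, if_neg, C_0, mul_zero]
            intro h
            exact hab (Fin.ext (by simp only at h; omega))
      rw [h6]
      exact W.sub_mem h4 (W.sum_mem fun b' hb' =>
        W.smul_mem _ (h3 b' (Finset.mem_filter.1 hb').2))
  -- Raising the power of `x` by one lowers the tail index by one, up to a constant row times `x ^
  -- m`; at tail index zero the row is a multiple of a row of `R`.
  have hall : ∀ m c a, (fun a' => X ^ m * divX^[c] (R a a')) ∈ W := by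
    intro m
    induction m with
    | zero => simpa using h1
    | succ m ih =>
      rintro (_ | c) a
      · exact h2 _ a
      · have h3 : (fun a' => X ^ (m + 1) * divX^[c + 1] (R a a')) =
            (fun a' => X ^ m * divX^[c] (R a a')) -
              ∑ b, (R a b).coeff c • (Pi.single b (X ^ m) : Fin p → ℂ[X]) := by
          ext1 a'
          rw [Pi.sub_apply, Finset.sum_apply]
          simp only [Pi.smul_apply, Pi.single_apply, smul_ite, smul_zero, Finset.sum_ite_eq,
            Finset.mem_univ, if_true]
          have h4 := X_mul_divX_add (divX^[c] (R a a'))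
          rw [coeff_iterate_divX, zero_add, ← Function.iterate_succ_apply' divX c] at h4
          rw [← h4, smul_eq_C_mul]
          ring
        rw [h3]
        exact W.sub_mem (ih c a) (W.sum_mem fun b _ => W.smul_mem _ (hconst m ih b))
  refine eq_top_iff.2 fun P _ => ?_
  have h3 : P = ∑ b, ∑ m ∈ Finset.range ((P b).natDegree + 1),
      (P b).coeff m • (Pi.single b (X ^ m) : Fin p → ℂ[X]) := by
    ext1 a
    conv_lhs => rw [(P a).as_sum_range_C_mul_X_pow]
    simp only [Finset.sum_apply, Pi.smul_apply, Pi.single_apply, smul_ite, smul_zero]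
    rw [Finset.sum_eq_single a]
    · simp [smul_eq_C_mul]
    · intro b _ hb
      simp [hb.symm]
    · simp
  rw [h3]
  exact W.sum_mem fun b _ => W.sum_mem fun m _ => W.smul_mem _ (hconst m (hall m) b)

variable [NeZero p]

/-- The row vector polynomial `∑_{l > c} (R_l)_a x^{l-c-1}`, where `e = c p + a`. -/
def tailRow (R : Matrix (Fin p) (Fin p) ℂ[X]) (e : ℕ) : Fin p → ℂ[X] :=
  fun a' => divX^[e / p + 1] (R (Fin.ofNat p e) a')

/-- At level `c = N - 1` the tail is a row of `R_N`, and the last `r` rows of `R_N` vanish; higher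
levels exceed the degree. -/
lemma HasLeadingForm.tailRow_eq_zero (hR : HasLeadingForm R N r) (hN : 1 ≤ N) (hr : r < p)
    {e : ℕ} (he : N * p - r ≤ e) : tailRow R e = 0 := by
  have hp : 0 < p := NeZero.pos p
  have hNp : p ≤ N * p := Nat.le_mul_of_pos_left p hN
  obtain ⟨N, rfl⟩ : ∃ n, N = n + 1 := ⟨N - 1, by omega⟩
  have h0 := Nat.mod_add_div e p
  have hlt := Nat.mod_lt e hp
  have h2 : (N + 1) * p = p * N + p := by ring
  have hN' : N ≤ e / p := by
    by_contra h
    have h1 : p * (e / p + 1) ≤ p * N := Nat.mul_le_mul_left p (by omega)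
    rw [mul_add, mul_one] at h1
    omega
  ext a' l
  rw [tailRow, coeff_iterate_divX, Pi.zero_apply, coeff_zero]
  by_cases h : l + (e / p + 1) = N + 1
  · rw [h, hR.leading, if_neg]
    rw [show e / p = N by omega] at h0
    simp only [Fin.ofNat]
    omega
  · exact coeff_eq_zero_of_natDegree_lt (lt_of_le_of_lt (hR.natDegree_le _ _) (by omega))

/-- The action of the Jordan chains on the row vector polynomials `tailRow R e` is nonsingular. -/
theorem HasLeadingForm.det_chainEval_ne_zero (hR : HasLeadingForm R N r) (hN : 1 ≤ N)
    (hr : r < p) (J : JordanData R) (hJ : N * p - r = J.size) :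
    (Matrix.of fun e c : Fin J.size => chainEval J (J.index c).1 (J.index c).2.1
      ((J.index c).2.2 : ℕ) (tailRow R e)).det ≠ 0 := by
  set K := Matrix.of fun e c : Fin J.size => chainEval J (J.index c).1 (J.index c).2.1
      ((J.index c).2.2 : ℕ) (tailRow R e) with hK
  let Φ : (Fin p → ℂ[X]) →ₗ[ℂ] (Fin J.size → ℂ) := LinearMap.pi fun c =>
    chainEval J (J.index c).1 (J.index c).2.1 ((J.index c).2.2 : ℕ)
  have hΦ : Function.Surjective Φ := by
    intro y
    -- The total size bounds every chain length; orders past the end of a chain get the irrelevant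
    -- value `0`.
    obtain ⟨P, hP⟩ := exists_forall_chainEval_eq J
      (fun i j k => if h : k < J.κ i j then y (J.index.symm ⟨i, j, ⟨k, h⟩⟩) else 0)
      (∑ i, ∑ j, J.κ i j)
    have key : ∀ t, chainEval J t.1 t.2.1 (t.2.2 : ℕ) P = y (J.index.symm t) := by
      rintro ⟨i, j, k⟩
      have hk : (k : ℕ) < ∑ i, ∑ j, J.κ i j := k.2.trans_le
        ((Finset.single_le_sum (f := J.κ i) (fun _ _ => Nat.zero_le _) (Finset.mem_univ j)).trans
          (Finset.single_le_sum (f := fun i => ∑ j, J.κ i j) (fun _ _ => Nat.zero_le _)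
            (Finset.mem_univ i)))
      have := hP i j k hk
      rwa [dif_pos k.2] at this
    refine ⟨P, funext fun c => ?_⟩
    have := key (J.index c)
    rwa [Equiv.symm_apply_apply] at this
  -- The row polynomials whose chain data lie in the row space of `K` include all generators: tail
  -- rows give rows of `K` or zero, multiples of rows of `R` give zero. Hence the row space is
  -- everything.
  have htop := hR.eq_top_of_mem hN hr ((LinearMap.range K.vecMulLinear).comap Φ) ?_ ?_
  · have hsurj : Function.Surjective K.vecMul := by
      intro y
      obtain ⟨P, rfl⟩ := hΦ y
      have : P ∈ (LinearMap.range K.vecMulLinear).comap Φ := by rw [htop]; trivial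
      exact this
    exact isUnit_iff_ne_zero.1 ((Matrix.isUnit_iff_isUnit_det _).1
      (Matrix.vecMul_surjective_iff_isUnit.1 hsurj))
  · rintro (_ | c) a
    · refine ⟨0, ?_⟩
      rw [map_zero]
      refine (funext fun c => ?_ : Φ _ = 0).symm
      have := chainEval_mul_row J (J.index c).2.2.2 1 a
      simp only [one_mul] at this
      exact this
    · have h1 : (fun a' => divX^[c + 1] (R a a')) = tailRow R (a + p * c) := by
        ext1 a'
        rw [tailRow, ofNat_add_mul, add_mul_div]
      rw [h1]
      by_cases h : (a : ℕ) + p * c < J.size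
      · refine ⟨Pi.single ⟨_, h⟩ 1, ?_⟩
        rw [Matrix.vecMulLinear_apply, Matrix.single_one_vecMul]
        rfl
      · rw [hR.tailRow_eq_zero hN hr (by omega)]
        exact zero_mem _
  · intro Q a
    refine ⟨0, ?_⟩
    rw [map_zero]
    exact (funext fun c => chainEval_mul_row J (J.index c).2.2.2 Q a : Φ _ = 0).symm

end Generation

/-! ### The discrete masses -/

section Masses

variable {q p : ℕ} {R : Matrix (Fin p) (Fin p) ℂ[X]} (J : JordanData R)
  {ξ : (i : Fin J.M) → Fin (J.s i) → ℕ → ℂ → Fin q → ℂ}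

lemma geronimus_eq (μ : Fin q → Fin p → Measure ℝ)
    (ξ : (i : Fin J.M) → Fin (J.s i) → ℕ → ℂ → Fin q → ℂ) (b : Fin q) (a : Fin p) (f : ℂ[X]) :
    geronimus μ J ξ b a f = densityPart μ R b a f +
      ∑ i, ∑ j, ∑ k ∈ Finset.range (J.κ i j),
        leftAction J i j k (fun t => f.eval t * ξ i j k t b) a := by
  simp only [leftAction_eq]
  rfl

/-- The Cauchy transform of the masses at `x_i`, without the factor `R`. -/
def massRow (ξ : (i : Fin J.M) → Fin (J.s i) → ℕ → ℂ → Fin q → ℂ) (P : Fin q → ℂ[X])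
    (i : Fin J.M) (z : ℂ) (a : Fin p) : ℂ :=
  ∑ j, ∑ k ∈ Finset.range (J.κ i j),
    leftAction J i j k (fun t => (∑ b, (P b).eval t * ξ i j k t b) / (z - t)) a

lemma massTransform_apply (ξ : (i : Fin J.M) → Fin (J.s i) → ℕ → ℂ → Fin q → ℂ)
    (B : ℕ → Fin q → ℂ[X]) (n : ℕ) (i : Fin J.M) (z : ℂ) (a'' : Fin p) :
    massTransform J ξ B n i z a'' = ∑ a, massRow J ξ (B n) i z a * (R a a'').eval z := by
  simp only [massTransform, massRow, Finset.sum_apply, Pi.smul_apply, smul_eq_mul, leftAction_eq,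
    Finset.sum_mul, Matrix.vecMul, dotProduct, Finset.mul_sum, derivAt_zero_apply]
  rw [Finset.sum_comm]
  refine Finset.sum_congr rfl fun j _ => ?_
  rw [Finset.sum_comm]
  refine Finset.sum_congr rfl fun k _ => ?_
  rw [Finset.sum_comm]
  exact Finset.sum_congr rfl fun l _ => Finset.sum_congr rfl fun a _ => by ring

variable (hξ : ∀ i j, ∀ k < J.κ i j, ∀ b, AnalyticAt ℂ (fun t => ξ i j k t b) (J.x i))
include hξ

lemma analyticAt_massRow {i : Fin J.M} {x : ℂ} (hx : x ≠ J.x i) (P : Fin q → ℂ[X]) (a : Fin p) :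
    AnalyticAt ℂ (fun z => massRow J ξ P i z a) x :=
  Finset.analyticAt_fun_sum _ fun j _ => Finset.analyticAt_fun_sum _ fun k hk =>
    analyticAt_leftAction_div J (Finset.analyticAt_fun_sum _ fun b _ =>
      (analyticAt_eval _ _).fun_mul (hξ i j k (Finset.mem_range.1 hk) b)) hx a

/-- The masses at `x_i` applied to the divided difference of `R`. -/
lemma sum_leftAction_divDiff {N : ℕ} (hN : ∀ a a', (R a a').natDegree ≤ N) {i : Fin J.M} {z : ℂ}
    (hz : z ≠ J.x i) (P : Fin q → ℂ[X]) (a'' : Fin p) :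
    ∑ b, ∑ a, ∑ j, ∑ k ∈ Finset.range (J.κ i j),
      leftAction J i j k (fun t => (P b * divDiff N (R a a'') z).eval t * ξ i j k t b) a =
      ∑ a, massRow J ξ P i z a * (R a a'').eval z := by
  have key : ∀ j, ∀ k ∈ Finset.range (J.κ i j), ∑ a, ∑ b,
      leftAction J i j k (fun t => (P b * divDiff N (R a a'') z).eval t * ξ i j k t b) a =
      ∑ a, leftAction J i j k (fun t => (∑ b, (P b).eval t * ξ i j k t b) / (z - t)) a *
        (R a a'').eval z := by
    intro j k hk
    have hk' := Finset.mem_range.1 hk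
    have hξ' := hξ i j k hk'
    have hG : AnalyticAt ℂ (fun t => (∑ b, (P b).eval t * ξ i j k t b) / (z - t)) (J.x i) :=
      (Finset.analyticAt_fun_sum _ fun b _ => (analyticAt_eval _ _).fun_mul (hξ' b)).fun_div
        (by fun_prop) (sub_ne_zero.2 hz.symm |> fun h => by rwa [← neg_sub, neg_ne_zero])
    -- Splitting `(R(z) - R(t)) / (z - t)` is legitimate near `t = x_i` since `z ≠ x_i`; after
    -- summing over `a` the left chain kills the second term.
    have h1 : ∀ a, ∑ b,
        leftAction J i j k (fun t => (P b * divDiff N (R a a'') z).eval t * ξ i j k t b) a =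
        (R a a'').eval z *
          leftAction J i j k (fun t => (∑ b, (P b).eval t * ξ i j k t b) / (z - t)) a -
        leftAction J i j k (fun t => (∑ b, (P b).eval t * ξ i j k t b) / (z - t) *
          (R a a'').eval t) a := by
      intro a
      rw [← leftAction_sum J fun b _ => (analyticAt_eval _ _).fun_mul (hξ' b),
        ← leftAction_const_mul, ← leftAction_sub J (analyticAt_const.fun_mul hG)
          (hG.fun_mul (analyticAt_eval _ _))]
      refine leftAction_congr J ?_ a
      filter_upwards [eventually_ne_nhds hz.symm] with t ht
      have h2 : z - t ≠ 0 := sub_ne_zero.2 ht.symm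
      have h3 : (divDiff N (R a a'') z).eval t = ((R a a'').eval z - (R a a'').eval t) / (z - t) := by
        rw [← sub_mul_eval_divDiff (hN a a''), mul_div_cancel_left₀ _ h2]
      have h4 : ∑ b, (P b * divDiff N (R a a'') z).eval t * ξ i j k t b =
          (∑ b, (P b).eval t * ξ i j k t b) * (divDiff N (R a a'') z).eval t := by
        rw [Finset.sum_mul]
        exact Finset.sum_congr rfl fun b _ => by rw [eval_mul]; ring
      rw [h4, h3]
      field_simp
    rw [Finset.sum_congr rfl fun a _ => h1 a, Finset.sum_sub_distrib,
      leftAction_mul_eq_zero J hk' hG, sub_zero]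
    exact Finset.sum_congr rfl fun a _ => mul_comm _ _
  rw [Finset.sum_comm]
  simp only [massRow, Finset.sum_mul]
  have h1 : ∀ a, ∑ b, ∑ j, ∑ k ∈ Finset.range (J.κ i j),
      leftAction J i j k (fun t => (P b * divDiff N (R a a'') z).eval t * ξ i j k t b) a =
      ∑ j, ∑ k ∈ Finset.range (J.κ i j), ∑ b,
      leftAction J i j k (fun t => (P b * divDiff N (R a a'') z).eval t * ξ i j k t b) a := by
    intro a
    rw [Finset.sum_comm]
    exact Finset.sum_congr rfl fun j _ => Finset.sum_comm
  rw [Finset.sum_congr rfl fun a _ => h1 a, Finset.sum_comm]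
  conv_rhs => rw [Finset.sum_comm]
  refine Finset.sum_congr rfl fun j _ => ?_
  rw [Finset.sum_comm]
  conv_rhs => rw [Finset.sum_comm]
  exact Finset.sum_congr rfl fun k hk => key j k hk

lemma sum_leftAction_mulVec {i : Fin J.M} {j : Fin (J.s i)} {k : ℕ} (hk : k < J.κ i j)
    (b : Fin q) (P : ℂ[X]) (Q : Fin p → ℂ[X]) :
    ∑ a, leftAction J i j k (fun t => (P * (R *ᵥ Q) a).eval t * ξ i j k t b) a = 0 := by
  have hg : ∀ a'', AnalyticAt ℂ (fun t => (P * Q a'').eval t * ξ i j k t b) (J.x i) :=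
    fun a'' => (analyticAt_eval _ _).fun_mul (hξ i j k hk b)
  have h1 : ∀ a, leftAction J i j k (fun t => (P * (R *ᵥ Q) a).eval t * ξ i j k t b) a =
      ∑ a'', leftAction J i j k
        (fun t => (P * Q a'').eval t * ξ i j k t b * (R a a'').eval t) a := by
    intro a
    rw [← leftAction_sum J fun a'' _ => (hg a'').fun_mul (analyticAt_eval _ _)]
    congr 1
    ext t
    simp only [Matrix.mulVec, dotProduct, eval_mul, eval_finsetSum, Finset.mul_sum, Finset.sum_mul]
    exact Finset.sum_congr rfl fun _ _ => by ring
  rw [Finset.sum_congr rfl fun a _ => h1 a, Finset.sum_comm]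
  exact Finset.sum_eq_zero fun a'' _ => leftAction_mul_eq_zero J hk (hg a'') a''

end Masses

/-! ### The perturbed functional -/

section Perturbed

variable {q p : ℕ} {R : Matrix (Fin p) (Fin p) ℂ[X]} (J : JordanData R)
  {ξ : (i : Fin J.M) → Fin (J.s i) → ℕ → ℂ → Fin q → ℂ}
  {μ : Fin q → Fin p → Measure ℝ} {Δ : Fin q → Fin p → Set ℝ}
  (hmom : ∀ b a, ∀ k : ℕ, Integrable (fun t : ℝ => t ^ k) (μ b a))
  (hΔ : ∀ b a, IsClosed (Δ b a)) (hμΔ : ∀ b a, μ b a (Δ b a)ᶜ = 0)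
  (hσ : ∀ b a, ∀ t ∈ Δ b a, ¬ R.det.IsRoot (t : ℂ))
  (hξ : ∀ i j, ∀ k < J.κ i j, ∀ b, AnalyticAt ℂ (fun t => ξ i j k t b) (J.x i))
include hmom hΔ hμΔ hσ hξ

lemma isLinearMap_geronimus (b : Fin q) (a : Fin p) : IsLinearMap ℂ (geronimus μ J ξ b a) := by
  have h := isLinearMap_densityPart hmom hΔ hμΔ hσ b a
  constructor
  · intro f g
    simp only [geronimus_eq, h.map_add, eval_add, add_mul]
    rw [add_add_add_comm]
    simp only [← Finset.sum_add_distrib]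
    congr 1
    refine Finset.sum_congr rfl fun i _ => Finset.sum_congr rfl fun j _ =>
      Finset.sum_congr rfl fun k hk => ?_
    have hξ' := hξ i j k (Finset.mem_range.1 hk) b
    exact leftAction_add J ((analyticAt_eval f _).fun_mul hξ') ((analyticAt_eval g _).fun_mul hξ') a
  · intro c f
    simp only [geronimus_eq, h.map_smul, eval_smul, smul_eq_mul, mul_assoc, mul_add,
      Finset.mul_sum, leftAction_const_mul]

/-- This is `dμ̌ R = dμ`: the density part cancels `R⁻¹` and the left chains annihilate `R`. -/
lemma sum_geronimus_mulVec (b : Fin q) (P : ℂ[X]) (Q : Fin p → ℂ[X]) :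
    ∑ a, geronimus μ J ξ b a (P * (R *ᵥ Q) a) = ∑ a, ofMeasure μ b a (P * Q a) := by
  simp only [geronimus_eq, Finset.sum_add_distrib, sum_densityPart_mul hmom hΔ hμΔ hσ]
  rw [add_eq_left, Finset.sum_comm]
  refine Finset.sum_eq_zero fun i _ => ?_
  rw [Finset.sum_comm]
  refine Finset.sum_eq_zero fun j _ => ?_
  rw [Finset.sum_comm]
  exact Finset.sum_eq_zero fun k hk =>
    sum_leftAction_mulVec J hξ (Finset.mem_range.1 hk) b P Q

/-- The perturbed functional applied to the divided difference of `R`. -/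
lemma pairing_divDiff {N : ℕ} (hN : ∀ a a', (R a a').natDegree ≤ N) {x : ℂ}
    (hx : ∀ b a, ∀ t ∈ Δ b a, (t : ℂ) ≠ x) (B : ℕ → Fin q → ℂ[X]) (n : ℕ) :
    ∀ᶠ z in 𝓝 x, (∀ i, z ≠ J.x i) → ∀ a'',
      pairing (geronimus μ J ξ) (B n) (fun a => divDiff N (R a a'') z) =
        ∑ a, densityTransform μ R (B n) z a * (R a a'').eval z - cauchyD μ B n z a'' +
          ∑ i, ∑ a, massRow J ξ (B n) i z a * (R a a'').eval z := by
  filter_upwards [sum_densityPart_divDiff hmom hΔ hμΔ hσ hN hx B n] with z hz hne a''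
  simp only [pairing, geronimus_eq, Finset.sum_add_distrib]
  rw [hz a'']
  congr 1
  rw [← Finset.sum_congr rfl fun i _ => sum_leftAction_divDiff J hξ hN (hne i) (B n) a'']
  conv_rhs => rw [Finset.sum_comm]
  exact Finset.sum_congr rfl fun b _ => Finset.sum_comm

/-- Near `x_i` the Cauchy transform of the masses is `D_n`, plus the perturbed functional applied
to the divided difference of `R`, up to an analytic multiple of `R`. -/
lemma exists_massTransform_eq {N : ℕ} (hN : ∀ a a', (R a a').natDegree ≤ N)
    (B : ℕ → Fin q → ℂ[X]) (n : ℕ) (i : Fin J.M) :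
    ∃ H : ℂ → Fin p → ℂ, (∀ a, AnalyticAt ℂ (fun y => H y a) (J.x i)) ∧
      ∀ᶠ z in 𝓝[≠] (J.x i), ∀ a'', massTransform J ξ B n i z a'' =
        pairing (geronimus μ J ξ) (B n) (fun a => divDiff N (R a a'') z) +
          cauchyD μ B n z a'' - ∑ a, H z a * (R a a'').eval z := by
  have hx : ∀ b a, ∀ t ∈ Δ b a, (t : ℂ) ≠ J.x i := fun b a t ht h =>
    hσ b a t ht ((J.isRoot_iff _).2 ⟨i, h.symm⟩)
  -- Everything multiplying `R(z)` except the masses at `x_i` itself: the density transform and the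
  -- masses at the other eigenvalues, all analytic at `x_i`.
  refine ⟨fun z a => densityTransform μ R (B n) z a +
    ∑ i' ∈ Finset.univ.erase i, massRow J ξ (B n) i' z a, fun a => ?_, ?_⟩
  · refine (analyticAt_densityTransform hmom hΔ hμΔ hσ hx (B n) a).fun_add
      (Finset.analyticAt_fun_sum _ fun i' hi' => analyticAt_massRow J hξ ?_ (B n) a)
    exact fun h => Finset.ne_of_mem_erase hi' (J.x_injective h).symm
  · have h1 : ∀ᶠ z in 𝓝[≠] (J.x i), ∀ i', z ≠ J.x i' := by
      refine Filter.eventually_all.2 fun i' => ?_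
      by_cases h : i' = i
      · subst h; exact eventually_mem_nhdsWithin
      · exact (eventually_ne_nhds fun h' => h (J.x_injective h').symm).filter_mono
          nhdsWithin_le_nhds
    filter_upwards [h1, (pairing_divDiff J hmom hΔ hμΔ hσ hξ hN hx B n).filter_mono
      nhdsWithin_le_nhds] with z hz1 hz2 a''
    rw [hz2 hz1 a'', massTransform_apply, ← Finset.add_sum_erase _ _ (Finset.mem_univ i)]
    simp only [add_mul, Finset.sum_add_distrib, Finset.sum_mul]
    rw [Finset.sum_comm (s := Finset.univ) (t := Finset.univ.erase i)]
    ring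

end Perturbed

/-! ### The rows `D_n - W_n` in terms of the integrals `I_{n,l}` -/

section Entries

variable {q p : ℕ} [NeZero p] {R : Matrix (Fin p) (Fin p) ℂ[X]} {N r : ℕ}

/-- The coefficient of `t ^ c` in the divided difference is the tail `∑_{l > c} R_l z^{l-c-1}`; the
sum stops at `N p - r` because later tail rows vanish. -/
lemma HasLeadingForm.divDiff_eq (hR : HasLeadingForm R N r) (hN : 1 ≤ N) (hr : r < p) (z : ℂ)
    (a'' : Fin p) : (fun a => divDiff N (R a a'') z) =
      ∑ e ∈ Finset.range (N * p - r), (tailRow R e a'').eval z • mono p e := by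
  have h : ∀ e, stepCoeff e (fun a => divDiff N (R a a'') z) =
      if e / p < N then (tailRow R e a'').eval z else 0 := by
    intro e
    rw [stepCoeff_apply, divDiff, finsetSum_coeff]
    simp only [coeff_C_mul, coeff_X_pow, mul_ite, mul_one, mul_zero, Finset.sum_ite_eq,
      Finset.mem_range]
    rfl
  rw [eq_sum_mono (Q := fun a => divDiff N (R a a'') z) (n := N * p - r)]
  · refine Finset.sum_congr rfl fun e he => ?_
    rw [h, if_pos]
    exact Nat.div_lt_of_lt_mul (by
      have := Finset.mem_range.1 he
      rw [mul_comm]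
      omega)
  · intro e he
    rw [h, hR.tailRow_eq_zero hN hr he]
    simp

variable (J : JordanData R) {ξ : (i : Fin J.M) → Fin (J.s i) → ℕ → ℂ → Fin q → ℂ}
  {μ : Fin q → Fin p → Measure ℝ} {Δ : Fin q → Fin p → Set ℝ}
  (hmom : ∀ b a, ∀ k : ℕ, Integrable (fun t : ℝ => t ^ k) (μ b a))
  (hΔ : ∀ b a, IsClosed (Δ b a)) (hμΔ : ∀ b a, μ b a (Δ b a)ᶜ = 0)
  (hσ : ∀ b a, ∀ t ∈ Δ b a, ¬ R.det.IsRoot (t : ℂ))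
  (hξ : ∀ i j, ∀ k < J.κ i j, ∀ b, AnalyticAt ℂ (fun t => ξ i j k t b) (J.x i))
include hmom hΔ hμΔ hσ hξ

lemma HasLeadingForm.pairing_divDiff_eq (hR : HasLeadingForm R N r) (hN : 1 ≤ N) (hr : r < p)
    (P : Fin q → ℂ[X]) (z : ℂ) (a'' : Fin p) :
    pairing (geronimus μ J ξ) P (fun a => divDiff N (R a a'') z) =
      ∑ e ∈ Finset.range (N * p - r),
        pairing (geronimus μ J ξ) P (mono p e) * (tailRow R e a'').eval z := by
  have h : ∀ Q, pairingLin
      (fun b a => (isLinearMap_geronimus J hmom hΔ hμΔ hσ hξ b a).mk' _) P Q =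
      pairing (geronimus μ J ξ) P Q := fun Q => rfl
  rw [← h, hR.divDiff_eq hN hr, map_sum]
  refine Finset.sum_congr rfl fun e _ => ?_
  rw [map_smul, h, smul_eq_mul, mul_comm]

/-- Near `x_i` the mass transform equals `∑ I_{n,e} tailRow_e + D_n` minus an analytic multiple of
`R`. The chain kills the multiple, and the `D_n` term cancels against `entryD`. -/
lemma HasLeadingForm.entryD_sub_entryW (hR : HasLeadingForm R N r) (hN : 1 ≤ N) (hr : r < p)
    (B : ℕ → Fin q → ℂ[X]) (n : ℕ) (i : Fin J.M) (j : Fin (J.s i)) {k : ℕ} (hk : k < J.κ i j) :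
    entryD μ J B n i j k - entryW J ξ B n i j k =
      -∑ e ∈ Finset.range (N * p - r),
        integralI (geronimus μ J ξ) B n e * chainEval J i j k (tailRow R e) := by
  obtain ⟨H, hH, hmass⟩ := exists_massTransform_eq J hmom hΔ hμΔ hσ hξ hR.natDegree_le B n i
  have hx : ∀ b a, ∀ t ∈ Δ b a, (t : ℂ) ≠ J.x i := fun b a t ht h =>
    hσ b a t ht ((J.isRoot_iff _).2 ⟨i, h.symm⟩)
  let T : ℂ → Fin p → ℂ := fun z a'' => ∑ e ∈ Finset.range (N * p - r),
    integralI (geronimus μ J ξ) B n e * (tailRow R e a'').eval z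
  let HR : ℂ → Fin p → ℂ := fun z a'' => ∑ a, H z a * (R a a'').eval z
  have hT : ∀ a, AnalyticAt ℂ (fun y => T y a) (J.x i) := fun a =>
    Finset.analyticAt_fun_sum _ fun e _ => analyticAt_const.fun_mul (analyticAt_eval _ _)
  have hD := analyticAt_cauchyD hmom hΔ hμΔ hx B n
  have hHR : ∀ a, AnalyticAt ℂ (fun y => HR y a) (J.x i) := fun a =>
    Finset.analyticAt_fun_sum _ fun a' _ => (hH a').fun_mul (analyticAt_eval _ _)
  let F : ℂ → Fin p → ℂ := fun z a => T z a + cauchyD μ B n z a - HR z a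
  have hTD : ∀ a, AnalyticAt ℂ (fun y => T y a + cauchyD μ B n y a) (J.x i) :=
    fun a => (hT a).fun_add (hD a)
  have hF : ∀ a, AnalyticAt ℂ (fun y => F y a) (J.x i) := fun a => (hTD a).fun_sub (hHR a)
  have heq : ∀ᶠ z in 𝓝[≠] (J.x i), massTransform J ξ B n i z = F z := by
    filter_upwards [hmass] with z hz
    ext1 a''
    rw [hz a'', hR.pairing_divDiff_eq J hmom hΔ hμΔ hσ hξ hN hr]
    rfl
  -- The chain action differentiates, so equality is needed on a full neighbourhood of each `z ≠
  -- x_i`, which the openness of the punctured plane provides.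
  have heq' : ∀ᶠ z in 𝓝[≠] (J.x i),
      chainAction J i j k (massTransform J ξ B n i) z = chainAction J i j k F z := by
    filter_upwards [eventually_eventually_nhdsWithin.2 heq, eventually_mem_nhdsWithin]
      with z hz hne
    refine chainAction_congr J ?_
    rwa [IsOpen.nhdsWithin_eq isOpen_compl_singleton hne] at hz
  -- The singularity is removable: `F` is analytic at `x_i`, so the limit is the value of its chain
  -- action there.
  have hlim : entryW J ξ B n i j k = chainAction J i j k F (J.x i) := by
    refine Filter.Tendsto.limUnder_eq ?_
    refine Filter.Tendsto.congr' (heq'.mono fun z hz => hz.symm) ?_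
    exact (continuousAt_chainAction J hF).tendsto.mono_left nhdsWithin_le_nhds
  have hsum : chainAction J i j k T (J.x i) = ∑ e ∈ Finset.range (N * p - r),
      integralI (geronimus μ J ξ) B n e * chainEval J i j k (tailRow R e) := by
    simp only [← chainAction_eval]
    exact chainAction_sum J fun e _ a => analyticAt_eval _ _
  have hzero : chainAction J i j k HR (J.x i) = 0 := chainAction_mul_eq_zero J hk hH
  rw [hlim, chainAction_sub J hTD hHR, chainAction_add J hT hD, hsum, hzero, entryD]
  change chainAction J i j k (cauchyD μ B n) (J.x i) -
    (_ + chainAction J i j k (cauchyD μ B n) (J.x i) - 0) = _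
  ring

theorem HasLeadingForm.tauDW_ne_zero_iff (hR : HasLeadingForm R N r) (hN : 1 ≤ N) (hr : r < p)
    (hJ : N * p - r = J.size) (B : ℕ → Fin q → ℂ[X]) (n : ℕ) :
    tauDW μ J ξ B (N * p - r) n ≠ 0 ↔
      Matrix.det (Matrix.of fun m e : Fin (N * p - r) =>
        integralI (geronimus μ J ξ) B (n + 1 - (N * p - r) + m) e) ≠ 0 := by
  have hdet := hR.det_chainEval_ne_zero hN hr J hJ
  have hrow : ∀ m c, rowDW μ J ξ B m c = -∑ e : Fin J.size, integralI (geronimus μ J ξ) B m e *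
      chainEval J (J.index c).1 (J.index c).2.1 ((J.index c).2.2 : ℕ) (tailRow R e) := by
    intro m c
    have h := hR.entryD_sub_entryW J hmom hΔ hμΔ hσ hξ hN hr B m (J.index c).1 (J.index c).2.1
      (J.index c).2.2.2
    rw [hJ, Finset.sum_range fun e => integralI (geronimus μ J ξ) B m e *
      chainEval J (J.index c).1 (J.index c).2.1 ((J.index c).2.2 : ℕ) (tailRow R e)] at h
    exact h
  rw [hJ]
  have hmul : (Matrix.of fun m c : Fin J.size => rowDW μ J ξ B (n + 1 - J.size + m) c) =
      -((Matrix.of fun m e : Fin J.size =>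
        integralI (geronimus μ J ξ) B (n + 1 - J.size + m) e) *
      (Matrix.of fun e c : Fin J.size => chainEval J (J.index c).1 (J.index c).2.1
        ((J.index c).2.2 : ℕ) (tailRow R e))) := by
    ext m c
    rw [Matrix.of_apply, hrow, Matrix.neg_apply, Matrix.mul_apply]
    rfl
  rw [tauDW, hmul, Matrix.det_neg, Matrix.det_mul]
  simp [hdet]

end Entries

end MixedGeronimus

end

/-! ### The main theorem -/

open MixedGeronimus
theorem mainTheorem5 {q p : ℕ} [NeZero q] [NeZero p]
    -- the matrix of measures, with finite moments
    (μ : Fin q → Fin p → MeasureTheory.Measure ℝ)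
    (hmom : ∀ b a, ∀ k : ℕ, MeasureTheory.Integrable (fun t : ℝ => t ^ k) (μ b a))
    -- closed sets carrying the measures
    (Δ : Fin q → Fin p → Set ℝ) (hΔ : ∀ b a, IsClosed (Δ b a))
    (hμΔ : ∀ b a, μ b a (Δ b a)ᶜ = 0)
    -- the original orthogonality exists
    (B : ℕ → Fin q → ℂ[X]) (A : ℕ → Fin p → ℂ[X])
    (hBA : IsMixedOrthogonal (ofMeasure μ) B A)
    -- the matrix polynomial
    (R : Matrix (Fin p) (Fin p) ℂ[X]) (N r : ℕ) (hN : 1 ≤ N) (hr : r < p)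
    (hR : HasLeadingForm R N r)
    (hσ : ∀ b a, ∀ t ∈ Δ b a, ¬ R.det.IsRoot (t : ℂ))
    -- its eigenvalues and Jordan chains, and the masses
    (J : JordanData R)
    (ξ : (i : Fin J.M) → Fin (J.s i) → ℕ → ℂ → Fin q → ℂ)
    (hξ : ∀ i j, ∀ k < J.κ i j, ∀ b, AnalyticAt ℂ (fun t => ξ i j k t b) (J.x i)) :
    (OrthogonalityExists (geronimus μ J ξ) ↔ ∀ n, tau μ J ξ B (N * p - r) n ≠ 0) ∧
    (tauGram (geronimus μ J ξ) B (N * p - r - 1) ≠ 0 ↔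
      tau μ J ξ B (N * p - r) (N * p - r - 1) ≠ 0) := by
  obtain ⟨hdet, hdeg⟩ := hR.natDegree_det hN hr
  have hJ : N * p - r = J.size := by rw [J.size_eq hdet, hdeg]
  have hpos : 0 < N * p - r := Nat.sub_pos_of_lt (hr.trans_le (Nat.le_mul_of_pos_left p hN))
  let w : Fin q → Fin p → ℂ[X] →ₗ[ℂ] ℂ := fun b a =>
    (isLinearMap_geronimus J hmom hΔ hμΔ hσ hξ b a).mk' _
  let u : Fin q → Fin p → ℂ[X] →ₗ[ℂ] ℂ := fun b a => (isLinearMap_ofMeasure hmom b a).mk' _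
  have hw : ∀ P Q, pairingLin w P (R *ᵥ Q) = pairingLin u P Q := fun P Q => by
    rw [pairingLin_apply, pairingLin_apply]
    exact Finset.sum_congr rfl fun b _ => sum_geronimus_mulVec J hmom hΔ hμΔ hσ hξ b (P b) Q
  have hgram : ∀ n, N * p - r ≤ n + 1 → (tauGram (geronimus μ J ξ) B n ≠ 0 ↔
      tau μ J ξ B (N * p - r) n ≠ 0) := fun n hn => by
    rw [tau, if_neg (not_lt.2 hn), hR.tauDW_ne_zero_iff J hmom hΔ hμΔ hσ hξ hN hr hJ]
    exact tauGram_ne_zero_iff hR hN hr hw (u := u) hBA hn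
  -- At `n = N p - r - 1` the comparison of the two determinants already applies, which is the
  -- second claim; for smaller `n` they agree by definition.
  refine ⟨?_, hgram _ (by omega)⟩
  obtain ⟨S, hS⟩ := hBA.exists_S
  refine (orthogonalityExists_iff_tauGram w hS).trans (forall_congr' fun n => ?_)
  rcases lt_or_ge (n + 1) (N * p - r) with h | h
  · rw [tau, if_pos h]
    rfl
  · exact hgram n h
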